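/- Let $k$ be a field and let $U,V,W$ be finite-dimensional $k$-vector spaces with $U\neq 0$ and $W\neq 0$; put $w=\dim W$. Let $S=\mathrm{Sym}(V)$, let $\mathfrak m\subset S$ be the ideal generated by $V$, and let $E=\wedge V^*$, with $V$ in degree $1$ and $V^*$ in degree $-1$. For a graded $E$-module $P$ let $\mathbf L(P)$ be the complex of graded free $S$-modules with terms $S\otimes P_i$, generated in degree $i$, and differentials $1\otimes p\mapsto\sum_j x_j\otimes e_jp$, where $(x_j)$ and $(e_j)$ are dual bases of $V$ and $V^*$. A pairing $\mu:W\otimes U\to V$ is *1-generic* if $\mu(a\otimes b)\neq0$ for all nonzero $a\in W$, $b\in U$, and *geometrically 1-generic* if $\mu\otimes\overline k$ is 1-generic over the algebraic closure $\overline k$. The dual $\mu^*:V^*\to W^*\otimes U^*$ extends to an algebra map from $E$ to $A=\bigoplus_l\wedge^lW^*\otimes\mathrm{Sym}_l(U^*)$; in this way the $A$-module $Q=\bigoplus_l\wedge^{l+1}W^*\otimes\mathrm{Sym}_l(U^*)$ is a graded $E$-module, with $\wedge^{l+1}W^*\otimes\mathrm{Sym}_l(U^*)$ in degree $-l$. Let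 $Q^*$ be its graded dual, $F_\bullet(\mu)=\mathbf L(Q^*)$, and let $D_l(U)=\mathrm{Sym}_l(U^*)^*$ be the degree $l$ piece of the divided power algebra. A complex $F_\bullet$ of graded $S$-modules is *standard linear free* if $F_i=0$ for $i<0$ and every $F_i$ is free with a basis in degree $i$; such a complex is *irredundant* if the induced maps $F_i/\mathfrak mF_i\to\mathfrak mF_{i-1}/\mathfrak m^2F_{i-1}$ are injective for all $i>0$. The *maximal irredundant quotient* of $F_\bullet$ is an irredundant standard linear free complex $F'_\bullet$ with a surjection $F_\bullet\to F'_\bullet$ (homogeneous of degree $0$) through which every such surjection from $F_\bullet$ to an irredundant standard linear free complex factors. **Theorem.** Suppose that $\mu:W\otimes U\to V$ is geometrically 1-generic. Then $F_\bullet(\mu)$ is a standard linear free complex with $F_i(\mu)=0$ for $i\ge w$, it has a maximal irredundant quotient $F'_\bullet(\mu)$, and these two complexes have the same last term and the same term in position $0$: the quotient maps $F_{w-1}(\mu)\to F'_{w-1}(\mu)$ and $F_0(\mu)\to F'_0(\mu)$ are isomorphisms, $F'_i(\mu)=0$ for $i\geq w$, and, as graded $S$-modules, $$F'_{w-1}(\mu)\cong\wedge^wW\otimes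 D_{w-1}(U)\otimes S(-w+1),\qquad F'_0(\mu)\cong W\otimes S.$$ Moreover, with respect to any bases $(w_j)$ of $W$ and $(v_i)$ of $V$, the $(w-1)\times(w-1)$ minors of the matrix over $\mathrm{Sym}(U^*)$ whose $(i,j)$ entry is the linear form $b\mapsto v_i^*(\mu(w_j\otimes b))$ on $U$ span $\mathrm{Sym}_{w-1}(U^*)$ over $k$. -/

import Mathlib

open scoped TensorProduct

noncomputable section

namespace BGG

universe u v w

/-! ### Graded pieces of the symmetric algebra -/

section Sym

variable (k : Type u) (M : Type v) [Field k] [AddCommGroup M] [Module k M]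

/-- `Sym_n(M)`, the degree `n` piece of the symmetric algebra of `M`. -/
def symPower (n : ℕ) : Submodule k (SymmetricAlgebra k M) :=
  LinearMap.range (SymmetricAlgebra.ι k M) ^ n

/-- `D_n(M)`, the degree `n` piece of the divided power algebra of a finite-dimensional vector
space `M`: the graded dual of the symmetric algebra of the dual space. -/
abbrev dividedPower (n : ℕ) : Type (max u v) :=
  Module.Dual k (symPower k (Module.Dual k M) n)

/-- The maximal ideal of `Sym(M)` generated by `M`. -/
def maxIdeal : Ideal (SymmetricAlgebra k M) :=
  Ideal.span (Set.range (SymmetricAlgebra.ι k M))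

/-- The algebra map `Sym(M) → Sym(M)[t]` which sends `m ∈ M` to `m t`. -/
def symShift : SymmetricAlgebra k M →ₐ[k] Polynomial (SymmetricAlgebra k M) :=
  SymmetricAlgebra.lift
    (((Polynomial.monomial (R := SymmetricAlgebra k M) 1).restrictScalars k) ∘ₗ
      SymmetricAlgebra.ι k M)

/-- The projection of `Sym(M)` to its piece of degree `n`. -/
def symProj (n : ℕ) : SymmetricAlgebra k M →ₗ[k] SymmetricAlgebra k M :=
  ((Polynomial.lcoeff (SymmetricAlgebra k M) n).restrictScalars k) ∘ₗ
    (symShift k M).toLinearMap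

variable {k M}

theorem symShift_of_mem {n : ℕ} {s : SymmetricAlgebra k M} (hs : s ∈ symPower k M n) :
    symShift k M s = Polynomial.monomial n s := by
  induction n generalizing s with
  | zero =>
    obtain ⟨r, rfl⟩ : ∃ r : k, algebraMap k _ r = s := by
      simpa [symPower, Submodule.mem_one] using hs
    rw [AlgHom.commutes]
    rfl
  | succ n ih =>
    rw [symPower, pow_succ] at hs
    induction hs using Submodule.mul_induction_on' with
    | mem_mul_mem a ha b hb =>
      obtain ⟨m, rfl⟩ := hb
      rw [map_mul, ih ha, symShift, SymmetricAlgebra.lift_ι_apply]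
      simp [Polynomial.monomial_mul_monomial]
    | add a _ b _ ha hb => rw [map_add, ha, hb, map_add]

theorem symProj_of_mem {n : ℕ} {s : SymmetricAlgebra k M} (hs : s ∈ symPower k M n) :
    symProj k M n s = s := by
  simp [symProj, symShift_of_mem hs]

theorem symProj_of_mem_ne {n m : ℕ} (h : m ≠ n) {s : SymmetricAlgebra k M}
    (hs : s ∈ symPower k M m) : symProj k M n s = 0 := by
  simp [symProj, symShift_of_mem hs, Polynomial.coeff_monomial, h]

theorem symPower_mul_mem {a b : ℕ} {s t : SymmetricAlgebra k M} (hs : s ∈ symPower k M a)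
    (ht : t ∈ symPower k M b) : s * t ∈ symPower k M (a + b) := by
  rw [symPower, pow_add]
  exact Submodule.mul_mem_mul hs ht

theorem ι_mem_symPower (m : M) : SymmetricAlgebra.ι k M m ∈ symPower k M 1 := by
  rw [symPower, pow_one]
  exact ⟨m, rfl⟩

theorem iSup_symPower : ⨆ n, symPower k M n = ⊤ := by
  rw [eq_top_iff]
  suffices h : ∀ x, x ∈ ⨆ n, symPower k M n from fun x _ => h x
  intro x
  induction x using SymmetricAlgebra.induction with
  | algebraMap r =>
    refine Submodule.mem_iSup_of_mem 0 ?_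
    rw [symPower, pow_zero]
    exact Submodule.mem_one.2 ⟨r, rfl⟩
  | ι x => exact Submodule.mem_iSup_of_mem 1 (ι_mem_symPower x)
  | mul a b ha hb =>
    induction ha using Submodule.iSup_induction' with
    | zero => simp
    | add x y _ _ hx hy => rw [add_mul]; exact add_mem hx hy
    | mem i x hx =>
      induction hb using Submodule.iSup_induction' with
      | zero => simp
      | add y z _ _ hy hz => rw [mul_add]; exact add_mem hy hz
      | mem j y hy => exact Submodule.mem_iSup_of_mem (i + j) (symPower_mul_mem hx hy)
  | add a b ha hb => exact add_mem ha hb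

end Sym

/-! ### Two auxiliary facts -/

section Aux

theorem isInternal_of_proj {k : Type*} [Field k] {N : Type*} [AddCommGroup N] [Module k N]
    {I : Type*} [DecidableEq I] (p : I → Submodule k N) {M : I → Type*}
    [∀ i, AddCommGroup (M i)] [∀ i, Module k (M i)] (c : ∀ i, N →ₗ[k] M i)
    (htop : ⨆ i, p i = ⊤) (hne : ∀ i j, j ≠ i → ∀ x ∈ p j, c i x = 0)
    (hinj : ∀ i, ∀ x ∈ p i, c i x = 0 → x = 0) : DirectSum.IsInternal p := by
  rw [DirectSum.isInternal_submodule_iff_iSupIndep_and_iSup_eq_top]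
  refine ⟨fun i => ?_, htop⟩
  rw [Submodule.disjoint_def]
  intro x hx hx'
  refine hinj i x hx ?_
  have : ⨆ j, ⨆ (_ : j ≠ i), p j ≤ LinearMap.ker (c i) :=
    iSup₂_le fun j hj y hy => hne i j hj y hy
  exact this hx'

theorem sum_alternating_eq_zero {I : Type*} [Fintype I] {N : Type*} [AddCommGroup N]
    (f : I → I → N) (hdiag : ∀ i, f i i = 0) (hanti : ∀ i j, f i j + f j i = 0) :
    ∑ i, ∑ j, f i j = 0 := by
  classical
  rw [← Fintype.sum_prod_type' f]
  refine Finset.sum_involution (fun a _ => (a.2, a.1)) (fun a _ => hanti a.1 a.2) ?_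
    (fun _ _ => Finset.mem_univ _) (fun _ _ => rfl)
  rintro ⟨i, j⟩ _ h h'
  obtain rfl : j = i := congrArg Prod.fst h'
  exact h (hdiag _)

end Aux

/-! ### Graded modules over the exterior algebra `E = ⋀ V^*` -/

/-- A graded module over `E = ⋀ V^*`, where the elements of `V^*` have degree `-1`. -/
structure GradedExtModule (k : Type u) (V : Type v) [Field k] [AddCommGroup V] [Module k V] where
  carrier : Type w
  [addCommGroup : AddCommGroup carrier]
  [moduleBase : Module k carrier]
  [moduleExt : Module (ExteriorAlgebra k (Module.Dual k V)) carrier]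
  [isScalarTower : IsScalarTower k (ExteriorAlgebra k (Module.Dual k V)) carrier]
  piece : ℤ → Submodule k carrier
  isInternal : DirectSum.IsInternal piece
  ι_smul_mem : ∀ (i : ℤ) (e : Module.Dual k V) (p : carrier), p ∈ piece i →
    ExteriorAlgebra.ι k e • p ∈ piece (i - 1)

attribute [instance] GradedExtModule.addCommGroup GradedExtModule.moduleBase
  GradedExtModule.moduleExt GradedExtModule.isScalarTower

section ExtModule

variable {k : Type u} {V : Type v} [Field k] [AddCommGroup V] [Module k V]

namespace GradedExtModule

variable (P : GradedExtModule.{u, v, w} k V)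

/-- The multiplication map of `e ∈ V^*` on `P`. -/
def act (e : Module.Dual k V) : P.carrier →ₗ[k] P.carrier :=
  Algebra.lsmul k k P.carrier (ExteriorAlgebra.ι k e)

theorem act_apply (e : Module.Dual k V) (p : P.carrier) :
    P.act e p = ExteriorAlgebra.ι k e • p := rfl

theorem act_act_self (e : Module.Dual k V) (p : P.carrier) : P.act e (P.act e p) = 0 := by
  rw [act_apply, act_apply, smul_smul, ExteriorAlgebra.ι_sq_zero, zero_smul]

theorem act_add (e f : Module.Dual k V) (p : P.carrier) :
    P.act (e + f) p = P.act e p + P.act f p := by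
  simp [act_apply, add_smul]

theorem act_smul (c : k) (e : Module.Dual k V) (p : P.carrier) :
    P.act (c • e) p = c • P.act e p := by
  rw [act_apply, act_apply, map_smul, smul_assoc]

theorem act_anti (e f : Module.Dual k V) (p : P.carrier) :
    P.act e (P.act f p) + P.act f (P.act e p) = 0 := by
  have h := P.act_act_self (e + f) p
  simp only [act_add, map_add, act_act_self, zero_add, add_zero] at h
  rw [← h, add_comm]

/-- The degree `i` piece of the graded dual `P^*`: the functionals on `P` which are supported on
the piece of degree `-i`. -/
def dualPiece (i : ℤ) : Submodule k (Module.Dual k P.carrier) where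
  carrier := {f | ∀ j, j ≠ -i → ∀ p ∈ P.piece j, f p = 0}
  zero_mem' := fun _ _ _ _ => rfl
  add_mem' := fun hf hg j hj p hp => by
    rw [LinearMap.add_apply, hf j hj p hp, hg j hj p hp, add_zero]
  smul_mem' := fun c f hf j hj p hp => by
    rw [LinearMap.smul_apply, hf j hj p hp, smul_zero]

/-- The graded dual of `P` as a vector space. -/
def dualSpace : Submodule k (Module.Dual k P.carrier) := ⨆ i, P.dualPiece i

theorem dualMap_act_mem_piece (e : Module.Dual k V) {i : ℤ} {f : Module.Dual k P.carrier}
    (hf : f ∈ P.dualPiece i) : (P.act e).dualMap f ∈ P.dualPiece (i - 1) := by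
  intro j hj p hp
  exact hf (j - 1) (by omega) _ (P.ι_smul_mem j e p hp)

theorem dualMap_act_mem (e : Module.Dual k V) (f : Module.Dual k P.carrier)
    (hf : f ∈ P.dualSpace) : (P.act e).dualMap f ∈ P.dualSpace := by
  have : P.dualSpace ≤ P.dualSpace.comap (P.act e).dualMap :=
    iSup_le fun i g hg => Submodule.mem_iSup_of_mem (i - 1) (P.dualMap_act_mem_piece e hg)
  exact this hf

/-- The graded dual of `P` as a type. -/
def DualCarrier : Type (max u w) := ↥P.dualSpace

instance : AddCommGroup P.DualCarrier := inferInstanceAs (AddCommGroup P.dualSpace)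

instance : Module k P.DualCarrier := inferInstanceAs (Module k P.dualSpace)

/-- The inclusion of the graded dual in the full dual space. -/
def dualIncl : P.DualCarrier →ₗ[k] Module.Dual k P.carrier := P.dualSpace.subtype

theorem dualIncl_injective : Function.Injective P.dualIncl := Subtype.val_injective

/-- The operation of `e ∈ V^*` on the graded dual, `(e f)(p) = f(e p)`. -/
def dualAct : Module.Dual k V →ₗ[k] Module.End k P.DualCarrier where
  toFun e := (P.act e).dualMap.restrict (P.dualMap_act_mem e)
  map_add' e f := LinearMap.ext fun g => Subtype.ext <| LinearMap.ext fun p => by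
    change P.dualIncl g (P.act (e + f) p) = P.dualIncl g (P.act e p) + P.dualIncl g (P.act f p)
    rw [act_add, map_add]
  map_smul' c e := LinearMap.ext fun g => Subtype.ext <| LinearMap.ext fun p => by
    change P.dualIncl g (P.act (c • e) p) = c • P.dualIncl g (P.act e p)
    rw [act_smul, map_smul]

theorem dualAct_apply (e : Module.Dual k V) (f : P.DualCarrier) (p : P.carrier) :
    P.dualIncl (P.dualAct e f) p = P.dualIncl f (P.act e p) := rfl

theorem dualAct_sq (e : Module.Dual k V) : P.dualAct e * P.dualAct e = 0 :=
  LinearMap.ext fun f => P.dualIncl_injective <| LinearMap.ext fun p => by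
    change P.dualIncl f (P.act e (P.act e p)) = 0
    rw [act_act_self, map_zero]

/-- The algebra map from `E` to the endomorphisms of the graded dual. -/
def dualHom : ExteriorAlgebra k (Module.Dual k V) →ₐ[k] Module.End k P.DualCarrier :=
  ExteriorAlgebra.lift k ⟨P.dualAct, P.dualAct_sq⟩

instance dualModule : Module (ExteriorAlgebra k (Module.Dual k V)) P.DualCarrier :=
  Module.compHom P.DualCarrier P.dualHom.toRingHom

theorem dual_smul_def (x : ExteriorAlgebra k (Module.Dual k V)) (f : P.DualCarrier) :
    x • f = P.dualHom x f := rfl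

theorem dual_ι_smul (e : Module.Dual k V) (f : P.DualCarrier) :
    ExteriorAlgebra.ι k e • f = P.dualAct e f := by
  rw [dual_smul_def, dualHom, ExteriorAlgebra.lift_ι_apply]

instance dualTower :
    IsScalarTower k (ExteriorAlgebra k (Module.Dual k V)) P.DualCarrier where
  smul_assoc c x f := by
    rw [dual_smul_def, dual_smul_def, map_smul, LinearMap.smul_apply]

theorem dual_isInternal : DirectSum.IsInternal fun i => (P.dualPiece i).comap P.dualIncl := by
  refine isInternal_of_proj (fun i => (P.dualPiece i).comap P.dualIncl)
    (M := fun i => Module.Dual k (P.piece (-i)))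
    (fun i => (P.piece (-i)).subtype.dualMap ∘ₗ P.dualIncl) ?_ ?_ ?_
  · have h : ∀ i, P.dualPiece i ≤ LinearMap.range P.dualIncl := fun i =>
      (le_iSup P.dualPiece i).trans_eq P.dualSpace.range_subtype.symm
    apply Submodule.map_injective_of_injective P.dualIncl_injective
    rw [Submodule.map_iSup, Submodule.map_top]
    simp only [Submodule.map_comap_eq, inf_eq_right.2 (h _)]
    exact P.dualSpace.range_subtype.symm
  · intro i j hj f hf
    exact LinearMap.ext fun p => hf (-i) (by omega) p p.2
  · intro i f hf h0
    apply P.dualIncl_injective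
    have : (⊤ : Submodule k P.carrier) ≤ LinearMap.ker (P.dualIncl f) := by
      rw [← P.isInternal.submodule_iSup_eq_top]
      refine iSup_le fun j p hp => ?_
      by_cases hj : j = -i
      · subst hj
        exact LinearMap.congr_fun h0 ⟨p, hp⟩
      · exact hf j hj p hp
    rw [map_zero]
    exact LinearMap.ext fun p => this trivial

/-- The graded dual `P^*` of a graded `E`-module, with `(P^*)_i` the dual space of `P_{-i}`. -/
def dual : GradedExtModule.{u, v, max u w} k V where
  carrier := P.DualCarrier
  piece i := (P.dualPiece i).comap P.dualIncl
  isInternal := P.dual_isInternal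
  ι_smul_mem i e f hf := by
    rw [dual_ι_smul]
    exact P.dualMap_act_mem_piece e hf

end GradedExtModule

end ExtModule

/-! ### Complexes of graded modules over `S = Sym(V)` -/

/-- A complex of graded modules over `S = Sym(V)` (with `V` in degree `1`) and of homogeneous maps
of degree `0`; `deg i n` is the degree `n` part of the `i`-th module. -/
structure GradedComplex (k : Type u) (V : Type v) [Field k] [AddCommGroup V] [Module k V] where
  X : ℤ → Type w
  [addCommGroup : ∀ i, AddCommGroup (X i)]
  [moduleBase : ∀ i, Module k (X i)]
  [moduleSym : ∀ i, Module (SymmetricAlgebra k V) (X i)]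
  [isScalarTower : ∀ i, IsScalarTower k (SymmetricAlgebra k V) (X i)]
  deg : ∀ i, ℤ → Submodule k (X i)
  isInternal : ∀ i, DirectSum.IsInternal (deg i)
  smul_mem : ∀ (i n : ℤ) (a : ℕ) (s : SymmetricAlgebra k V) (x : X i), s ∈ symPower k V a →
    x ∈ deg i n → s • x ∈ deg i (n + a)
  d : ∀ i, X i →ₗ[SymmetricAlgebra k V] X (i - 1)
  d_mem : ∀ (i n : ℤ) (x : X i), x ∈ deg i n → d i x ∈ deg (i - 1) n
  d_d : ∀ (i : ℤ) (x : X i), d (i - 1) (d i x) = 0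

attribute [instance] GradedComplex.addCommGroup GradedComplex.moduleBase
  GradedComplex.moduleSym GradedComplex.isScalarTower

section Complex

variable {k : Type u} {V : Type v} [Field k] [AddCommGroup V] [Module k V]

namespace GradedComplex

/-- A map of graded complexes, homogeneous of degree `0`. -/
structure Hom (F G : GradedComplex.{u, v, w} k V) where
  f : ∀ i, F.X i →ₗ[SymmetricAlgebra k V] G.X i
  deg_mem : ∀ (i n : ℤ) (x : F.X i), x ∈ F.deg i n → f i x ∈ G.deg i n
  comm : ∀ (i : ℤ) (x : F.X i), f (i - 1) (F.d i x) = G.d i (f i x)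

/-- A standard linear free complex: the modules `F_i` vanish for `i < 0`, and every `F_i` is a free
`S`-module with a basis of elements of degree `i`. -/
def IsStandardLinearFree (F : GradedComplex.{u, v, w} k V) : Prop :=
  (∀ i, i < 0 → Subsingleton (F.X i)) ∧
  ∀ i, ∃ B : Set (F.X i), B ⊆ F.deg i i ∧ LinearIndepOn (SymmetricAlgebra k V) id B ∧
    Submodule.span (SymmetricAlgebra k V) B = ⊤

/-- Irredundancy (linear exactness) of a standard linear free complex: the maps
`F_i / 𝔪 F_i → 𝔪 F_{i-1} / 𝔪² F_{i-1}` induced by the differentials are injective for `i > 0`. -/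
def IsIrredundant (F : GradedComplex.{u, v, w} k V) : Prop :=
  ∀ i, 0 < i → ∀ x : F.X i,
    F.d i x ∈ (maxIdeal k V ^ 2 • ⊤ : Submodule (SymmetricAlgebra k V) (F.X (i - 1))) →
    x ∈ (maxIdeal k V • ⊤ : Submodule (SymmetricAlgebra k V) (F.X i))

/-- `π : F → F'` is the maximal irredundant quotient of `F`: a surjection to an irredundant
standard linear free complex through which every such surjection factors. -/
structure IsMaximalIrredundantQuotient {F F' : GradedComplex.{u, v, w} k V} (π : Hom F F') :
    Prop where
  surjective : ∀ i, Function.Surjective (π.f i)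
  linearFree : F'.IsStandardLinearFree
  irredundant : F'.IsIrredundant
  factors : ∀ (G : GradedComplex.{u, v, w} k V) (ρ : Hom F G),
    (∀ i, Function.Surjective (ρ.f i)) → G.IsStandardLinearFree → G.IsIrredundant →
    ∃ σ : Hom F' G, ∀ i, ρ.f i = σ.f i ∘ₗ π.f i

end GradedComplex

/-- The degree `n` part of the graded free module `S(-i) ⊗ T`, which is `Sym_{n-i}(V) ⊗ T`. -/
def freeDeg (k : Type u) (V : Type v) [Field k] [AddCommGroup V] [Module k V]
    (T : Type w) [AddCommGroup T] [Module k T] (i n : ℤ) :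
    Submodule k (SymmetricAlgebra k V ⊗[k] T) :=
  if i ≤ n then
    Submodule.map₂ (TensorProduct.mk k (SymmetricAlgebra k V) T) (symPower k V (n - i).toNat) ⊤
  else ⊥

section Free

variable {T : Type w} [AddCommGroup T] [Module k T]

theorem tmul_mem_freeDeg {a : ℕ} {s : SymmetricAlgebra k V} (hs : s ∈ symPower k V a) (t : T)
    {i n : ℤ} (h : i + a = n) : s ⊗ₜ[k] t ∈ freeDeg k V T i n := by
  have h1 : i ≤ n := by omega
  have h2 : (n - i).toNat = a := by omega
  rw [freeDeg, if_pos h1, h2]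
  exact Submodule.apply_mem_map₂ _ hs trivial

theorem freeDeg_le {i n : ℤ} {N : Submodule k (SymmetricAlgebra k V ⊗[k] T)}
    (h : ∀ (a : ℕ) (s : SymmetricAlgebra k V) (t : T), i + a = n → s ∈ symPower k V a →
      s ⊗ₜ[k] t ∈ N) : freeDeg k V T i n ≤ N := by
  rw [freeDeg]
  split_ifs with hi
  · exact Submodule.map₂_le.2 fun s hs t _ => h _ s t (by omega) hs
  · exact bot_le

theorem isInternal_freeDeg (i : ℤ) : DirectSum.IsInternal (freeDeg k V T i) := by
  have hc : ∀ n m : ℤ, freeDeg k V T i m ≤ LinearMap.ker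
      ((symProj k V (n - i).toNat).rTensor T - if m = n then LinearMap.id else 0) ∨ n < i := by
    intro n m
    by_cases hn : n < i
    · exact Or.inr hn
    refine Or.inl (freeDeg_le fun a s t ha hs => ?_)
    rw [LinearMap.mem_ker, LinearMap.sub_apply, LinearMap.rTensor_tmul]
    split_ifs with h
    · have : (n - i).toNat = a := by omega
      rw [this, symProj_of_mem hs]
      simp
    · rw [symProj_of_mem_ne (m := a) (by omega) hs]
      simp
  refine isInternal_of_proj _
    (fun n => (symProj k V (n - i).toNat).rTensor T - if n < i then
      (symProj k V (n - i).toNat).rTensor T else 0) ?_ ?_ ?_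
  · rw [eq_top_iff]
    suffices h : ∀ x, x ∈ ⨆ n, freeDeg k V T i n from fun x _ => h x
    intro x
    induction x using TensorProduct.induction_on with
    | zero => exact zero_mem _
    | add x y hx hy => exact add_mem hx hy
    | tmul s t =>
      have hs : s ∈ ⨆ n, symPower k V n := iSup_symPower (k := k) (M := V) ▸ trivial
      induction hs using Submodule.iSup_induction' with
      | zero => simp
      | add x y _ _ hx hy => rw [TensorProduct.add_tmul]; exact add_mem hx hy
      | mem a x hx => exact Submodule.mem_iSup_of_mem (i + a) (tmul_mem_freeDeg hx t rfl)
  · intro n m hm x hx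
    split_ifs with hn
    · simp
    · have := ((hc n m).resolve_right hn) hx
      simpa [hm] using this
  · intro n x hx h0
    split_ifs at h0 with hn
    · rw [freeDeg, if_neg (by omega)] at hx
      exact hx
    · have := ((hc n n).resolve_right hn) hx
      simp only [if_true, LinearMap.mem_ker, LinearMap.sub_apply, LinearMap.id_apply] at this h0
      rw [LinearMap.zero_apply, sub_zero] at h0
      rw [h0, zero_sub, neg_eq_zero] at this
      exact this

end Free

section Functor

variable [FiniteDimensional k V] (P : GradedExtModule.{u, v, w} k V)

/-- The multiplication map `P_i → P_{i-1}` of `e ∈ V^*`. -/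
def pieceAct (i : ℤ) (e : Module.Dual k V) : P.piece i →ₗ[k] P.piece (i - 1) :=
  (P.act e).restrict (P.ι_smul_mem i e)

/-- The differential `S ⊗ P_i → S ⊗ P_{i-1}`, `s ⊗ p ↦ ∑ s x_j ⊗ e_j p`, where `x_j` and `e_j`
are dual bases of `V` and `V^*`. -/
def linDiff (i : ℤ) : SymmetricAlgebra k V ⊗[k] P.piece i →ₗ[SymmetricAlgebra k V]
    SymmetricAlgebra k V ⊗[k] P.piece (i - 1) :=
  ∑ j, TensorProduct.AlgebraTensorModule.map
    (LinearMap.mulRight (SymmetricAlgebra k V)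
      (SymmetricAlgebra.ι k V (Module.finBasis k V j)))
    (pieceAct P i ((Module.finBasis k V).coord j))

theorem linDiff_tmul (i : ℤ) (s : SymmetricAlgebra k V) (p : P.piece i) :
    linDiff P i (s ⊗ₜ[k] p) = ∑ j, (s * SymmetricAlgebra.ι k V (Module.finBasis k V j)) ⊗ₜ[k]
      pieceAct P i ((Module.finBasis k V).coord j) p := by
  simp [linDiff, LinearMap.sum_apply]

/-- The linear free complex `L(P)` of a graded `E`-module `P`, with `L(P)_i = S ⊗ P_i` generated in
degree `i`. -/
def linComplex : GradedComplex.{u, v, max u v w} k V where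
  X i := SymmetricAlgebra k V ⊗[k] P.piece i
  deg i n := freeDeg k V (P.piece i) i n
  isInternal i := isInternal_freeDeg i
  smul_mem i n a s x hs hx := by
    have : freeDeg k V (P.piece i) i n ≤ (freeDeg k V (P.piece i) i (n + a)).comap
        (Algebra.lsmul k k (SymmetricAlgebra k V ⊗[k] P.piece i) s) := by
      refine freeDeg_le fun b r t hb hr => ?_
      rw [Submodule.mem_comap, Algebra.lsmul_coe]
      change (s * r) ⊗ₜ[k] t ∈ _
      exact tmul_mem_freeDeg (symPower_mul_mem hs hr) t (by push_cast; omega)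
    exact this hx
  d i := linDiff P i
  d_mem i n x hx := by
    have : freeDeg k V (P.piece i) i n ≤ (freeDeg k V (P.piece (i - 1)) (i - 1) n).comap
        ((linDiff P i).restrictScalars k) := by
      refine freeDeg_le fun b r t hb hr => ?_
      rw [Submodule.mem_comap, LinearMap.restrictScalars_apply, linDiff_tmul]
      exact sum_mem fun j _ => tmul_mem_freeDeg (symPower_mul_mem hr (ι_mem_symPower _)) _
        (by push_cast; omega)
    exact this hx
  d_d i x := by
    induction x using TensorProduct.induction_on with
    | zero => simp
    | add x y hx hy => rw [map_add, map_add, hx, hy, add_zero]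
    | tmul s p =>
      rw [linDiff_tmul, map_sum]
      simp only [linDiff_tmul]
      refine sum_alternating_eq_zero _ (fun j => ?_) (fun j l => ?_)
      · rw [show pieceAct P (i - 1) ((Module.finBasis k V).coord j)
          (pieceAct P i ((Module.finBasis k V).coord j) p) = 0 from
            Subtype.ext (P.act_act_self _ _), TensorProduct.tmul_zero]
      · rw [mul_right_comm s, ← TensorProduct.tmul_add,
          show pieceAct P (i - 1) ((Module.finBasis k V).coord l)
              (pieceAct P i ((Module.finBasis k V).coord j) p) +
            pieceAct P (i - 1) ((Module.finBasis k V).coord j)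
              (pieceAct P i ((Module.finBasis k V).coord l) p) = 0 from
            Subtype.ext (P.act_anti _ _ _), TensorProduct.tmul_zero]

end Functor

end Complex

/-! ### The algebra `A`, the module `Q` and the complex `F(μ)` of a pairing -/

section Pairing

variable (k : Type u) [Field k] (W : Type*) (U : Type*) [AddCommGroup W] [Module k W]
  [AddCommGroup U] [Module k U]

/-- The algebra `⋀ W^* ⊗ Sym(U^*)`. -/
abbrev bigAlg := ExteriorAlgebra k (Module.Dual k W) ⊗[k] SymmetricAlgebra k (Module.Dual k U)

/-- The piece `⋀^a W^* ⊗ Sym_b(U^*)` of `⋀ W^* ⊗ Sym(U^*)`. -/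
def bigPiece (a b : ℕ) : Submodule k (bigAlg k W U) :=
  Submodule.map₂
    (TensorProduct.mk k (ExteriorAlgebra k (Module.Dual k W))
      (SymmetricAlgebra k (Module.Dual k U)))
    (⋀[k]^a (Module.Dual k W)) (symPower k (Module.Dual k U) b)

variable {k W U}

theorem bigPiece_mul_mem {a b c d : ℕ} {x y : bigAlg k W U} (hx : x ∈ bigPiece k W U a b)
    (hy : y ∈ bigPiece k W U c d) : x * y ∈ bigPiece k W U (a + c) (b + d) := by
  have h : bigPiece k W U a b * bigPiece k W U c d ≤ bigPiece k W U (a + c) (b + d) := by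
    rw [bigPiece, bigPiece, Submodule.map₂_eq_span_image2, Submodule.map₂_eq_span_image2,
      Submodule.span_mul_span, Submodule.span_le]
    rintro _ ⟨_, ⟨p, hp, q, hq, rfl⟩, _, ⟨r, hr, s, hs, rfl⟩, rfl⟩
    simp only [TensorProduct.mk_apply, Algebra.TensorProduct.tmul_mul_tmul]
    refine Submodule.apply_mem_map₂ (TensorProduct.mk k _ _) ?_ (symPower_mul_mem hq hs)
    rw [ExteriorAlgebra.exteriorPower, pow_add]
    exact Submodule.mul_mem_mul hp hr
  exact h (Submodule.mul_mem_mul hx hy)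

variable (k W U)

/-- The algebra `A = ⊕_l ⋀^l W^* ⊗ Sym_l(U^*)`. -/
def algA : Subalgebra k (bigAlg k W U) :=
  (⨆ l, bigPiece k W U l l).toSubalgebra
    (by
      refine Submodule.mem_iSup_of_mem 0 ?_
      rw [Algebra.TensorProduct.one_def]
      refine Submodule.apply_mem_map₂ (TensorProduct.mk k _ _) ?_ ?_
      · rw [ExteriorAlgebra.exteriorPower, pow_zero]
        exact Submodule.one_le.1 le_rfl
      · rw [symPower, pow_zero]
        exact Submodule.one_le.1 le_rfl)
    (by
      intro x y hx hy
      induction hx using Submodule.iSup_induction' with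
      | zero => simp
      | add x y _ _ hx hy => rw [add_mul]; exact add_mem hx hy
      | mem i x hx =>
        induction hy using Submodule.iSup_induction' with
        | zero => simp
        | add y z _ _ hy hz => rw [mul_add]; exact add_mem hy hz
        | mem j y hy => exact Submodule.mem_iSup_of_mem (i + j) (bigPiece_mul_mem hx hy))

/-- The vector space `Q = ⊕_l ⋀^{l+1} W^* ⊗ Sym_l(U^*)`. -/
def modQ : Submodule k (bigAlg k W U) := ⨆ l, bigPiece k W U (l + 1) l

theorem algA_mul_modQ_mem (x y : bigAlg k W U) (hx : x ∈ algA k W U) (hy : y ∈ modQ k W U) :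
    x * y ∈ modQ k W U := by
  replace hx : x ∈ ⨆ l, bigPiece k W U l l := hx
  rw [modQ] at hy ⊢
  induction hx using Submodule.iSup_induction' with
  | zero => simp
  | add x y _ _ hx hy => rw [add_mul]; exact add_mem hx hy
  | mem i x hx =>
    induction hy using Submodule.iSup_induction' with
    | zero => simp
    | add y z _ _ hy hz => rw [mul_add]; exact add_mem hy hz
    | mem j y hy =>
      refine Submodule.mem_iSup_of_mem (i + j) ?_
      rw [add_assoc]
      exact bigPiece_mul_mem hx hy

/-- The `A`-module structure of `Q`: the elements of `A` operate by multiplication. -/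
def actQ : algA k W U →ₐ[k] Module.End k (modQ k W U) :=
  AlgHom.ofLinearMap
    { toFun := fun x => (LinearMap.mulLeft k (x : bigAlg k W U)).restrict
        fun y hy => algA_mul_modQ_mem k W U x y x.2 hy
      map_add' := fun _ _ => LinearMap.ext fun _ => Subtype.ext (add_mul _ _ _)
      map_smul' := fun c _ => LinearMap.ext fun _ => Subtype.ext (smul_mul_assoc c _ _) }
    (LinearMap.ext fun _ => Subtype.ext (one_mul _))
    (fun _ _ => LinearMap.ext fun _ => Subtype.ext (mul_assoc _ _ _))

/-- The inclusion of `W^* ⊗ U^*` in `⋀ W^* ⊗ Sym(U^*)`. -/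
def inclOne : Module.Dual k W ⊗[k] Module.Dual k U →ₗ[k] bigAlg k W U :=
  TensorProduct.map (ExteriorAlgebra.ι k) (SymmetricAlgebra.ι k (Module.Dual k U))

variable {k W U}

theorem inclOne_mem_bigPiece (z : Module.Dual k W ⊗[k] Module.Dual k U) :
    inclOne k W U z ∈ bigPiece k W U 1 1 := by
  induction z using TensorProduct.induction_on with
  | zero => simp
  | add x y hx hy => rw [map_add]; exact add_mem hx hy
  | tmul x y =>
    refine Submodule.apply_mem_map₂ (TensorProduct.mk k _ _) ?_ (ι_mem_symPower y)
    rw [ExteriorAlgebra.exteriorPower, pow_one]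
    exact ⟨x, rfl⟩

theorem inclOne_mem (z : Module.Dual k W ⊗[k] Module.Dual k U) :
    inclOne k W U z ∈ algA k W U :=
  Submodule.mem_iSup_of_mem 1 (inclOne_mem_bigPiece z)

theorem inclOne_anti (y z : Module.Dual k W ⊗[k] Module.Dual k U) :
    inclOne k W U y * inclOne k W U z + inclOne k W U z * inclOne k W U y = 0 := by
  induction y using TensorProduct.induction_on with
  | zero => simp
  | add a b ha hb =>
    rw [map_add, add_mul, mul_add, add_add_add_comm, ha, hb, add_zero]
  | tmul a b =>
    induction z using TensorProduct.induction_on with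
    | zero => simp
    | add c d hc hd =>
      rw [map_add, add_mul, mul_add, add_add_add_comm, hc, hd, add_zero]
    | tmul c d =>
      simp only [inclOne, TensorProduct.map_tmul, Algebra.TensorProduct.tmul_mul_tmul]
      rw [mul_comm (SymmetricAlgebra.ι k _ d), ← TensorProduct.add_tmul,
        ExteriorAlgebra.ι_add_mul_swap, TensorProduct.zero_tmul]

theorem inclOne_sq (z : Module.Dual k W ⊗[k] Module.Dual k U) :
    inclOne k W U z * inclOne k W U z = 0 := by
  induction z using TensorProduct.induction_on with
  | zero => simp
  | add a b ha hb =>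
    rw [map_add, add_mul, mul_add, mul_add, ha, hb, zero_add, add_zero, inclOne_anti]
  | tmul a b =>
    simp [inclOne, Algebra.TensorProduct.tmul_mul_tmul]

end Pairing

section FMu

variable {k : Type u} [Field k] {U V W : Type*} [AddCommGroup U] [Module k U]
  [AddCommGroup V] [Module k V] [AddCommGroup W] [Module k W]
  [FiniteDimensional k U] [FiniteDimensional k W]

/-- The dual `μ^* : V^* → W^* ⊗ U^*` of a pairing. -/
def dualPairing (μ : W ⊗[k] U →ₗ[k] V) :
    Module.Dual k V →ₗ[k] Module.Dual k W ⊗[k] Module.Dual k U :=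
  (TensorProduct.dualDistribEquiv k W U).symm.toLinearMap ∘ₗ μ.dualMap

/-- The algebra map `E = ⋀ V^* → A` which extends `μ^*`. -/
def extMap (μ : W ⊗[k] U →ₗ[k] V) :
    ExteriorAlgebra k (Module.Dual k V) →ₐ[k] algA k W U :=
  ExteriorAlgebra.lift k
    ⟨(inclOne k W U ∘ₗ dualPairing μ).codRestrict (Subalgebra.toSubmodule (algA k W U))
      fun e => inclOne_mem (dualPairing μ e),
     fun e => Subtype.ext (inclOne_sq (dualPairing μ e))⟩

/-- The vector space `Q`, regarded as an `E`-module through `E → A`. -/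
def carrierQ (_μ : W ⊗[k] U →ₗ[k] V) := ↥(modQ k W U)

instance (μ : W ⊗[k] U →ₗ[k] V) : AddCommGroup (carrierQ μ) :=
  inferInstanceAs (AddCommGroup (modQ k W U))

instance (μ : W ⊗[k] U →ₗ[k] V) : Module k (carrierQ μ) :=
  inferInstanceAs (Module k (modQ k W U))

/-- The operation of `E` on `Q` through `E → A`. -/
def extActQ (μ : W ⊗[k] U →ₗ[k] V) :
    ExteriorAlgebra k (Module.Dual k V) →ₐ[k] Module.End k (carrierQ μ) :=
  (actQ k W U).comp (extMap μ)

instance (μ : W ⊗[k] U →ₗ[k] V) :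
    Module (ExteriorAlgebra k (Module.Dual k V)) (carrierQ μ) :=
  Module.compHom (carrierQ μ) (extActQ μ).toRingHom

theorem carrierQ_smul_def (μ : W ⊗[k] U →ₗ[k] V) (x : ExteriorAlgebra k (Module.Dual k V))
    (q : carrierQ μ) : x • q = extActQ μ x q := rfl

instance (μ : W ⊗[k] U →ₗ[k] V) :
    IsScalarTower k (ExteriorAlgebra k (Module.Dual k V)) (carrierQ μ) where
  smul_assoc c x q := by
    rw [carrierQ_smul_def, carrierQ_smul_def, map_smul, LinearMap.smul_apply]

/-- The inclusion of `Q` in `⋀ W^* ⊗ Sym(U^*)`. -/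
def carrierQ.incl (μ : W ⊗[k] U →ₗ[k] V) : carrierQ μ →ₗ[k] bigAlg k W U :=
  (modQ k W U).subtype

/-- The graded `E`-module `Q`, with `⋀^{l+1} W^* ⊗ Sym_l(U^*)` in degree `-l`. -/
def gradedQ (μ : W ⊗[k] U →ₗ[k] V) : GradedExtModule k V where
  carrier := carrierQ μ
  piece i := (if i ≤ 0 then bigPiece k W U ((-i).toNat + 1) (-i).toNat else ⊥).comap
    (carrierQ.incl μ)
  isInternal := by
    have hinj : Function.Injective (carrierQ.incl μ) := Subtype.val_injective
    have hproj : ∀ (n a b : ℕ) (x : bigAlg k W U), x ∈ bigPiece k W U a b →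
        (symProj k (Module.Dual k U) n).lTensor (ExteriorAlgebra k (Module.Dual k W)) x =
          if b = n then x else 0 := by
      intro n a b x hx
      have : bigPiece k W U a b ≤ LinearMap.ker
          ((symProj k (Module.Dual k U) n).lTensor (ExteriorAlgebra k (Module.Dual k W)) -
            if b = n then LinearMap.id else 0) := by
        refine Submodule.map₂_le.2 fun y _ s hs => ?_
        rw [LinearMap.mem_ker, LinearMap.sub_apply, TensorProduct.mk_apply,
          LinearMap.lTensor_tmul]
        split_ifs with h
        · subst h
          rw [symProj_of_mem hs]
          simp
        · rw [symProj_of_mem_ne h hs]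
          simp
      have h := this hx
      rw [LinearMap.mem_ker, LinearMap.sub_apply, sub_eq_zero] at h
      rw [h]
      split_ifs <;> rfl
    refine isInternal_of_proj _
      (fun i => if i ≤ 0 then (symProj k (Module.Dual k U) (-i).toNat).lTensor
        (ExteriorAlgebra k (Module.Dual k W)) ∘ₗ carrierQ.incl μ else 0) ?_ ?_ ?_
    · rw [eq_top_iff]
      rintro ⟨x, hx⟩ _
      replace hx : x ∈ ⨆ l, bigPiece k W U (l + 1) l := hx
      have key : ∀ y ∈ ⨆ l, bigPiece k W U (l + 1) l, ∃ q : carrierQ μ, carrierQ.incl μ q = y ∧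
          q ∈ ⨆ i : ℤ, (if i ≤ 0 then bigPiece k W U ((-i).toNat + 1) (-i).toNat else ⊥).comap
            (carrierQ.incl μ) := by
        intro y hy
        induction hy using Submodule.iSup_induction' with
        | zero => exact ⟨0, map_zero _, zero_mem _⟩
        | add y z _ _ hy hz =>
          obtain ⟨p, rfl, hp⟩ := hy
          obtain ⟨q, rfl, hq⟩ := hz
          exact ⟨p + q, map_add _ _ _, add_mem hp hq⟩
        | mem l y hy =>
          refine ⟨⟨y, Submodule.mem_iSup_of_mem l hy⟩, rfl,
            Submodule.mem_iSup_of_mem (-(l : ℤ)) ?_⟩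
          change y ∈ (if -(l : ℤ) ≤ 0 then bigPiece k W U ((-(-(l : ℤ))).toNat + 1)
            (-(-(l : ℤ))).toNat else ⊥)
          rw [if_pos (by omega), neg_neg, Int.toNat_natCast]
          exact hy
      obtain ⟨q, hq, hq'⟩ := key x hx
      have : q = ⟨x, hx⟩ := hinj hq
      rw [← this]
      exact hq'
    · intro i j hj q hq
      rw [Submodule.mem_comap] at hq
      by_cases hj0 : j ≤ 0
      · rw [if_pos hj0] at hq
        by_cases hi0 : i ≤ 0
        · rw [if_pos hi0, LinearMap.comp_apply, hproj _ _ _ _ hq, if_neg (by omega)]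
        · rw [if_neg hi0, LinearMap.zero_apply]
      · rw [if_neg hj0, Submodule.mem_bot] at hq
        rw [hinj (hq.trans (map_zero _).symm), map_zero]
    · intro i q hq h0
      rw [Submodule.mem_comap] at hq
      split_ifs at hq with hi
      · rw [if_pos hi, LinearMap.comp_apply, hproj _ _ _ _ hq, if_pos rfl] at h0
        exact hinj (h0.trans (map_zero _).symm)
      · exact hinj (((Submodule.mem_bot k).1 hq).trans (map_zero _).symm)
  ι_smul_mem i e q hq := by
    rw [Submodule.mem_comap] at hq ⊢
    have h : carrierQ.incl μ (ExteriorAlgebra.ι k e • q) =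
        inclOne k W U (dualPairing μ e) * carrierQ.incl μ q := by
      change (extMap μ (ExteriorAlgebra.ι k e) : bigAlg k W U) * carrierQ.incl μ q = _
      rw [extMap, ExteriorAlgebra.lift_ι_apply]
      rfl
    rw [h]
    split_ifs at hq with hi
    · rw [if_pos (by omega), show (-(i - 1)).toNat = 1 + (-i).toNat by omega, add_assoc]
      exact bigPiece_mul_mem (inclOne_mem_bigPiece _) hq
    · rw [(Submodule.mem_bot k).1 hq, mul_zero]
      exact zero_mem _

/-- The linear free complex `F(μ) = L(Q^*)`. -/
def complexF [FiniteDimensional k V] (μ : W ⊗[k] U →ₗ[k] V) : GradedComplex k V :=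
  linComplex (gradedQ μ).dual

end FMu

/-! ### `1`-generic pairings and the associated matrix of linear forms -/

section Generic

variable {k : Type*} [Field k] {U V W : Type*} [AddCommGroup U] [Module k U]
  [AddCommGroup V] [Module k V] [AddCommGroup W] [Module k W]

/-- A pairing is `1`-generic if `μ(a ⊗ b) ≠ 0` for all nonzero `a` and `b`. -/
def IsOneGeneric (μ : W ⊗[k] U →ₗ[k] V) : Prop :=
  ∀ (a : W) (b : U), a ≠ 0 → b ≠ 0 → μ (a ⊗ₜ[k] b) ≠ 0

/-- The pairing induced by `μ` over the algebraic closure `K` of `k`, namely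
`(K ⊗ W) ⊗_K (K ⊗ U) ≃ K ⊗ (W ⊗ U) → K ⊗ V`. -/
def closurePairing (μ : W ⊗[k] U →ₗ[k] V) :
    (AlgebraicClosure k ⊗[k] W) ⊗[AlgebraicClosure k] (AlgebraicClosure k ⊗[k] U)
      →ₗ[AlgebraicClosure k] AlgebraicClosure k ⊗[k] V :=
  μ.baseChange (AlgebraicClosure k) ∘ₗ
    (TensorProduct.AlgebraTensorModule.distribBaseChange k (AlgebraicClosure k) W U).symm.toLinearMap

/-- A pairing is geometrically `1`-generic if it is `1`-generic over the algebraic closure. -/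
def IsGeometricallyOneGeneric (μ : W ⊗[k] U →ₗ[k] V) : Prop :=
  IsOneGeneric (closurePairing μ)

/-- The matrix over `Sym(U^*)` of the linear map `W ⊗ Sym(U^*) → V ⊗ Sym(U^*)(1)` associated to
`μ`: its entry at `(i, j)` is the linear form on `U` which takes `b` to the `i`-th coordinate of
`μ(w_j ⊗ b)`. -/
def linearMatrix {m n : Type*} (bW : Module.Basis n k W) (bV : Module.Basis m k V)
    (μ : W ⊗[k] U →ₗ[k] V) : Matrix m n (SymmetricAlgebra k (Module.Dual k U)) :=
  Matrix.of fun i j =>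
    SymmetricAlgebra.ι k (Module.Dual k U) (bV.coord i ∘ₗ μ ∘ₗ TensorProduct.mk k W U (bW j))

/-- The `k`-linear span of the `d × d` minors of a matrix. -/
def minorSpan (k : Type*) [Field k] {R : Type*} [CommRing R] [Algebra k R] {m n : Type*}
    (M : Matrix m n R) (d : ℕ) : Submodule k R :=
  Submodule.span k
    {x | ∃ (r : Fin d ↪ m) (c : Fin d ↪ n), x = (M.submatrix r c).det}

end Generic

end BGG

end

/-! Everything reduces to the statement on minors. Let `P = Q^*`, and call an element of `P_i`
redundant if all products of `i` elements of `V^*` kill it. The redundant elements form a graded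
submodule, and dividing `L(P)` by them gives the maximal irredundant quotient
(`irrHom_isMaximalIrredundantQuotient`). The quotient is irredundant because an element all of whose
multiples by `V^*` are redundant in degree `i - 1` is itself redundant in degree `i`. Conversely,
let `ρ` map to an irredundant standard linear free complex. By induction on `i` the differential of
the image of a redundant generator vanishes, so this image lies in `𝔪 G_i`; it has degree `i`, hence
it is zero (`apply_one_tmul_eq_zero`).

In position `0` only the empty product occurs, so nothing is redundant. In position `w - 1`, a
redundant functional on `⋀^w W^* ⊗ Sym_{w-1}(U^*)` vanishes on all products of `w - 1` elements of
`V^*` with elements of `W^* = Q_0`. Applied to the last dual basis vector, these products are the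
volume form tensor the `(w-1)`-minors of the linear matrix without its last column
(`list_prod_mul_ι`). If these minors span `Sym_{w-1}(U^*)`, nothing is redundant there either
(`redundant_dualQ_eq_bot`).

The minors are handled over the algebraic closure, and linear algebra brings the result back to `k`.
Choose `n` columns; column `i` gives vectors `g i j = μ(w_i ⊗ u_j)` and a Koszul differential `T_i =
∑_j (contraction with g i j) ⊗ x_j` on `⋀ V^* ⊗ k[x]`. The `T_i` anticommute. By 1-genericity the
vectors of a nonzero combination of columns are independent, so every nonzero combination of the
`T_i` is exact in positive polynomial degree (`exists_koszulDiff_apply_eq`). An eigenvalue argument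
shows that the common kernel of such a family is the image of its product
(`exists_mul_apply_of_exact_pencil`, `exists_prod_apply_of_exact`). For a form `p` of degree `n`,
every `T_i` kills `1 ⊗ p`, so `1 ⊗ p = T_1 ⋯ T_n y` with `y` of polynomial degree `0`. The scalar
component of the right side is an alternating form evaluated on generic combinations of the `g i j`,
hence a combination of `n`-minors. -/

open scoped TensorProduct

noncomputable section

namespace BGG

universe u v w

/-! ### Common kernels of anticommuting differentials -/

section Socle

variable {k N : Type*} [Field k] [AddCommGroup N] [Module k N]

/-- If `a`, `b` are anticommuting differentials all of whose nonzero combinations are exact in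
positive degrees, then the common kernel of `a` and `b` is the image of `a b`. -/
theorem exists_mul_apply_of_exact_pencil [IsAlgClosed k] (P : ℕ → Submodule k N)
    [∀ q, FiniteDimensional k (P q)] (a b : Module.End k N)
    (haa : ∀ x, a (a x) = 0) (hbb : ∀ x, b (b x) = 0) (hab : ∀ x, a (b x) = - b (a x))
    (haP : ∀ q, ∀ x ∈ P q, a x ∈ P (q + 1)) (hbP : ∀ q, ∀ x ∈ P q, b x ∈ P (q + 1))
    (hexa : ∀ q, ∀ x ∈ P (q + 1), a x = 0 → ∃ y ∈ P q, a y = x)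
    (hexb : ∀ c : k, ∀ q, ∀ x ∈ P (q + 1), (b - c • a) x = 0 → ∃ y ∈ P q, (b - c • a) y = x)
    (q : ℕ) (x : N) (hx : x ∈ P (q + 2)) (hax : a x = 0) (hbx : b x = 0) :
    ∃ y ∈ P q, a (b y) = x := by
  set Z : Submodule k N := P (q + 2) ⊓ (LinearMap.ker a ⊓ LinearMap.ker b) with hZ
  have memZ : ∀ {z}, z ∈ Z ↔ z ∈ P (q + 2) ∧ a z = 0 ∧ b z = 0 := by
    intro z; simp [hZ]
  set B : Submodule k Z := ((P q).map (a * b)).comap Z.subtype with hB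
  have memB : ∀ {z : Z}, z ∈ B ↔ ∃ y ∈ P q, a (b y) = z := by
    intro z; simp [hB]
  have : FiniteDimensional k Z := Submodule.finiteDimensional_of_le (inf_le_left : Z ≤ P (q + 2))
  suffices h : B = ⊤ from memB.1 (h ▸ Submodule.mem_top : (⟨x, memZ.2 ⟨hx, hax, hbx⟩⟩ : Z) ∈ B)
  by_contra hne
  -- a linear section of `a` over `Z`
  let P' : Submodule k N := P (q + 1) ⊓ Z.comap a
  let a' : P' →ₗ[k] Z := a.restrict fun z hz => hz.2
  have ha' : LinearMap.range a' = ⊤ := by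
    rw [LinearMap.range_eq_top]
    rintro ⟨z, hz⟩
    obtain ⟨y, hy, rfl⟩ := hexa (q + 1) z (memZ.1 hz).1 (memZ.1 hz).2.1
    exact ⟨⟨y, hy, hz⟩, rfl⟩
  obtain ⟨σ, hσ⟩ := a'.exists_rightInverse_of_surjective ha'
  have hσa : ∀ z : Z, a (σ z : N) = z := fun z => congrArg Subtype.val (LinearMap.congr_fun hσ z)
  have hσP : ∀ z : Z, (σ z : N) ∈ P (q + 1) := fun z => (σ z).2.1
  -- Modulo `B` this is the map "`b` composed with the inverse of `a`"; an eigenvalue `c` of it will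
  -- contradict the exactness of `b - c a`.
  let θ : Z →ₗ[k] Z := (b ∘ₗ P'.subtype ∘ₗ σ).codRestrict Z fun z => by
    refine memZ.2 ⟨hbP _ _ (hσP z), ?_, hbb _⟩
    change a (b (σ z : N)) = 0
    rw [hab, hσa, (memZ.1 z.2).2.2, neg_zero]
  have hθ : ∀ z : Z, (θ z : N) = b (σ z : N) := fun _ => rfl
  -- If `z = a b y`, then `σ z - b y` is killed by `a`, hence equals some `a m`, and `θ z = b a m =
  -- a b (-m)`.
  have hθB : B ≤ B.comap θ := by
    intro z hz
    obtain ⟨y, hy, hyz⟩ := memB.1 hz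
    obtain ⟨m, hm, hm'⟩ := hexa q ((σ z : N) - b y) (sub_mem (hσP z) (hbP _ _ hy)) (by
      rw [map_sub, hσa, hyz, sub_self])
    refine memB.2 ⟨-m, neg_mem hm, ?_⟩
    rw [hθ, ← sub_add_cancel (σ z : N) (b y), ← hm', map_add, hbb, add_zero, map_neg, map_neg, hab,
      neg_neg]
  have : Nontrivial (Z ⧸ B) := Submodule.Quotient.nontrivial_iff.2 hne
  obtain ⟨c, hc⟩ := Module.End.exists_eigenvalue (K := k) (B.mapQ B θ hθB)
  obtain ⟨v, hv⟩ := hc.exists_hasEigenvector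
  obtain ⟨z, rfl⟩ := B.mkQ_surjective v
  refine hv.2 ?_
  have h1 : θ z - c • z ∈ B := by
    have := hv.apply_eq_smul
    rw [← sub_eq_zero, Submodule.mkQ_apply, Submodule.mapQ_apply, ← Submodule.Quotient.mk_smul,
      ← Submodule.Quotient.mk_sub, Submodule.Quotient.mk_eq_zero] at this
    exact this
  obtain ⟨n, hn, hn'⟩ := memB.1 h1
  -- The eigenvector equation reads `b σ z - c z = a b n`. Correcting the lift `σ z` of `z` by `a n`
  -- puts it in the kernel of `b - c a` and does not change its image under `a`.
  obtain ⟨m, hm, hm'⟩ := hexb c q ((σ z : N) + a n) (add_mem (hσP z) (haP _ _ hn)) (by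
    have h2 : a (b n) = b (σ z : N) - c • (z : N) := hn'
    simp only [LinearMap.sub_apply, LinearMap.smul_apply, map_add, hσa, haa]
    rw [smul_zero, sub_zero, ← h2, hab, neg_add_cancel])
  rw [Submodule.mkQ_apply, Submodule.Quotient.mk_eq_zero]
  refine memB.2 ⟨m, hm, ?_⟩
  have h3 : a ((σ z : N) + a n) = z := by rw [map_add, hσa, haa, add_zero]
  rw [← h3, ← hm', LinearMap.sub_apply, map_sub, LinearMap.smul_apply, map_smul, haa, smul_zero,
    sub_zero]

/-- Common kernels over an exterior algebra: if every nonzero combination of the anticommuting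
differentials `T i` is exact in positive degrees, then an element killed by all `T i` is in the
image of their product. -/
theorem exists_prod_apply_of_exact [IsAlgClosed k] {n : ℕ} (P : ℕ → Submodule k N)
    [∀ q, FiniteDimensional k (P q)] (T : Fin n → Module.End k N)
    (hsq : ∀ i x, T i (T i x) = 0) (hanti : ∀ i j x, T i (T j x) = - T j (T i x))
    (hP : ∀ i q, ∀ x ∈ P q, T i x ∈ P (q + 1))
    (hex : ∀ c : Fin n → k, c ≠ 0 → ∀ q, ∀ x ∈ P (q + 1), (∑ i, c i • T i) x = 0 →
      ∃ y ∈ P q, (∑ i, c i • T i) y = x)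
    (q : ℕ) (x : N) (hx : x ∈ P (q + n)) (hTx : ∀ i, T i x = 0) :
    ∃ y ∈ P q, (List.ofFn T).prod y = x := by
  induction n generalizing P q x with
  | zero => exact ⟨x, hx, by simp⟩
  | succ n ih =>
    have hex0 : ∀ q, ∀ x ∈ P (q + 1), T 0 x = 0 → ∃ y ∈ P q, T 0 y = x := by
      have := hex (Pi.single 0 1) (by simp)
      simpa [Finset.sum_eq_single (0 : Fin (n + 1)), Pi.single_apply] using this
    obtain ⟨z, hz, rfl⟩ := hex0 (q + n) x hx (hTx 0)
    -- The induction runs on the image of `T 0`, which the other operators preserve up to sign. The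
    -- pencil lemma for `T 0` and a combination of the others supplies the exactness needed there.
    obtain ⟨y, hy, hy'⟩ := ih (fun q => (P q).map (T 0)) (fun i => T i.succ) (fun i => hsq _)
      (fun i j => hanti _ _)
      (by
        rintro i q _ ⟨x, hx, rfl⟩
        exact ⟨- T i.succ x, neg_mem (hP _ _ _ hx), by rw [map_neg, hanti, neg_neg]⟩)
      (by
        rintro c hc q _ ⟨x, hx, rfl⟩ h0
        have hb : ∀ d : k, (∑ i, c i • T i.succ) - d • T 0 = ∑ i, (Fin.cons (-d) c : Fin (n + 1) → k) i • T i := by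
          intro d
          rw [Fin.sum_univ_succ]
          simp [sub_eq_neg_add]
        have hb0 : ∀ x, (∑ i, c i • T i.succ) x = ∑ i, c i • T i.succ x := fun x => by
          simp
        obtain ⟨y, hy, hy'⟩ := exists_mul_apply_of_exact_pencil P (T 0) (∑ i, c i • T i.succ)
          (hsq 0) (fun x => by
            simp only [hb0, map_sum, map_smul, Finset.smul_sum]
            refine sum_alternating_eq_zero _ (fun i => by simp [hsq]) fun i j => ?_
            rw [hanti, smul_neg, smul_neg, smul_comm, neg_add_cancel])
          (fun x => by
            simp only [hb0, map_sum, map_smul, ← Finset.sum_neg_distrib]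
            exact Finset.sum_congr rfl fun i _ => by rw [hanti, smul_neg])
          (hP 0) (fun q x hx => by
            rw [hb0]
            exact sum_mem fun i _ => Submodule.smul_mem _ _ (hP _ _ _ hx))
          hex0
          (fun d q x hx h => by
            rw [hb] at h ⊢
            refine hex _ (fun h => hc ?_) q x hx h
            funext i
            simpa using congrFun h i.succ)
          q (T 0 x) (hP 0 _ _ hx) (hsq 0 x) h0
        refine ⟨T 0 (-y), ⟨-y, neg_mem hy, rfl⟩, ?_⟩
        rw [← hy', hb0, hb0, map_sum]
        exact Finset.sum_congr rfl fun i _ => by rw [map_smul, hanti, map_neg, map_neg, neg_neg])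
      q (T 0 z) ⟨z, hz, rfl⟩ (fun i => hTx _)
    obtain ⟨y, hy, rfl⟩ := hy
    -- Moving `T 0` to the front of the product costs a sign for each factor, and the signs are
    -- absorbed in the preimage.
    have key : ∀ (l : List (Module.End k N)), (∀ t ∈ l, ∀ x, T 0 (t x) = - t (T 0 x)) →
        ∀ y ∈ P q, ∃ y' ∈ P q, T 0 (l.prod y') = l.prod (T 0 y) := by
      intro l
      induction l with
      | nil => exact fun _ y hy => ⟨y, hy, rfl⟩
      | cons t l ihl =>
        intro h y hy
        obtain ⟨y', hy', e⟩ := ihl (fun s hs => h s (List.mem_cons_of_mem _ hs)) y hy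
        refine ⟨-y', neg_mem hy', ?_⟩
        rw [List.prod_cons, Module.End.mul_apply, Module.End.mul_apply, h t (by simp), map_neg,
          map_neg, map_neg, neg_neg, e]
    obtain ⟨y', hy'', e⟩ := key (List.ofFn fun i : Fin n => T i.succ) (by
      intro t ht x
      obtain ⟨i, rfl⟩ := (List.mem_ofFn' _ _).1 ht
      exact hanti _ _ _) y hy
    exact ⟨y', hy'', by rw [List.ofFn_succ, List.prod_cons, Module.End.mul_apply, e, hy']⟩

end Socle

/-! ### Exactness of Koszul differentials in arbitrary characteristic -/

section Koszul

open MvPolynomial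

variable {k : Type*} [Field k] {Λ : Type*} [AddCommGroup Λ] [Module k Λ] {σ : Type*}

variable (k) in
/-- Multiplication by a variable. -/
def mulX (j : σ) : Module.End k (MvPolynomial σ k) := LinearMap.mulLeft k (X j)

variable (k) in
/-- Division by a variable, discarding the remainder. -/
def divX (j : σ) : Module.End k (MvPolynomial σ k) where
  toFun p := p.divMonomial (Finsupp.single j 1)
  map_add' p q := add_divMonomial p q _
  map_smul' c p := by
    ext α
    simp

/-- The inverse is one-sided: `1 - mulX k j * divX k j` projects to the polynomials without the
variable. Using this division instead of a partial derivative avoids dividing by the degree. -/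
theorem divX_mul_mulX (j : σ) : divX k j * mulX k j = 1 :=
  LinearMap.ext fun p => X_mul_divMonomial j p

theorem mulX_mul_mulX (i j : σ) : mulX k i * mulX k j = mulX k j * mulX k i :=
  LinearMap.ext fun p => mul_left_comm (X i) (X j) p

theorem divX_mul_mulX_of_ne {i j : σ} (h : i ≠ j) : divX k i * mulX k j = mulX k j * divX k i := by
  classical
  suffices key : ∀ (p : MvPolynomial σ k) (α : σ →₀ ℕ),
      coeff α ((X j * p).divMonomial (Finsupp.single i 1)) =
        coeff α (X j * p.divMonomial (Finsupp.single i 1)) from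
    LinearMap.ext fun p => MvPolynomial.ext _ _ (key p)
  intro p α
  rw [coeff_divMonomial, coeff_X_mul', coeff_X_mul', coeff_divMonomial]
  have : j ∈ (Finsupp.single i 1 + α).support ↔ j ∈ α.support := by
    simp [h]
  by_cases hj : j ∈ α.support
  · rw [if_pos hj, if_pos (this.2 hj)]
    congr 1
    rw [add_tsub_assoc_of_le]
    simpa [Nat.one_le_iff_ne_zero] using hj
  · rw [if_neg hj, if_neg (fun h => hj (this.1 h))]

theorem mulX_mem {j : σ} {q : ℕ} {p : MvPolynomial σ k} (hp : p ∈ homogeneousSubmodule σ k q) :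
    mulX k j p ∈ homogeneousSubmodule σ k (q + 1) := by
  rw [add_comm]
  exact (isHomogeneous_X k j).mul hp

theorem divX_mem {j : σ} {q : ℕ} {p : MvPolynomial σ k}
    (hp : p ∈ homogeneousSubmodule σ k (q + 1)) : divX k j p ∈ homogeneousSubmodule σ k q := by
  intro α hα
  change coeff α (p.divMonomial _) ≠ 0 at hα
  rw [coeff_divMonomial] at hα
  have := hp hα
  rw [map_add, Finsupp.weight_single] at this
  simp only [Pi.one_apply, smul_eq_mul, mul_one] at this
  omega

variable (Λ σ) in
/-- The polynomials of degree `q` with coefficients in a vector space. -/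
def polyPiece (q : ℕ) : Submodule k (Λ ⊗[k] MvPolynomial σ k) :=
  Submodule.map₂ (TensorProduct.mk k Λ (MvPolynomial σ k)) ⊤ (homogeneousSubmodule σ k q)

instance [FiniteDimensional k Λ] [Finite σ] (q : ℕ) :
    FiniteDimensional k (polyPiece (k := k) Λ σ q) :=
  Module.Finite.iff_fg.2 (Submodule.FG.map₂ _ Module.Finite.fg_top (homogeneousSubmodule_fg σ k q))

theorem tmul_mem_polyPiece (l : Λ) {q : ℕ} {p : MvPolynomial σ k}
    (hp : p ∈ homogeneousSubmodule σ k q) : l ⊗ₜ[k] p ∈ polyPiece (k := k) Λ σ q :=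
  Submodule.apply_mem_map₂ _ trivial hp

theorem map_mem_polyPiece {f : Module.End k Λ} {g : Module.End k (MvPolynomial σ k)} {q r : ℕ}
    (hg : ∀ p ∈ homogeneousSubmodule σ k q, g p ∈ homogeneousSubmodule σ k r)
    {x : Λ ⊗[k] MvPolynomial σ k} (hx : x ∈ polyPiece (k := k) Λ σ q) :
    TensorProduct.map f g x ∈ polyPiece (k := k) Λ σ r := by
  have : polyPiece (k := k) Λ σ q ≤ (polyPiece (k := k) Λ σ r).comap (TensorProduct.map f g) :=
    Submodule.map₂_le.2 fun l _ p hp => tmul_mem_polyPiece (f l) (hg p hp)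
  exact this hx

/-- The summand `c x_j` of a Koszul differential. -/
def koszulTerm (c : σ → Module.End k Λ) (j : σ) : Module.End k (Λ ⊗[k] MvPolynomial σ k) :=
  TensorProduct.map (c j) (mulX k j)

theorem koszulTerm_mem (c : σ → Module.End k Λ) (j : σ) {q : ℕ} {x : Λ ⊗[k] MvPolynomial σ k}
    (hx : x ∈ polyPiece (k := k) Λ σ q) :
    koszulTerm c j x ∈ polyPiece (k := k) Λ σ (q + 1) :=
  map_mem_polyPiece (fun _ => mulX_mem) hx

/-- A contracting homotopy of the Koszul differential `∑ c_j x_j`, valid in any characteristic. -/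
theorem exists_koszul_homotopy [DecidableEq σ] (c e : σ → Module.End k Λ)
    (hsq : ∀ i, c i * c i = 0) (hce : ∀ i j, c i * e j + e j * c i = if i = j then 1 else 0)
    (hcc : ∀ i j, c i * c j = -(c j * c i))
    (s : Finset σ) :
    ∃ (H : Module.End k (Λ ⊗[k] MvPolynomial σ k)) (A : Module.End k Λ)
      (B : Module.End k (MvPolynomial σ k)),
      (∑ j ∈ s, koszulTerm c j) * H + H * (∑ j ∈ s, koszulTerm c j) = 1 - TensorProduct.map A B ∧
      (∀ j, j ∉ s → koszulTerm c j * H + H * koszulTerm c j = 0) ∧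
      (∀ q, ∀ x ∈ polyPiece (k := k) Λ σ (q + 1), H x ∈ polyPiece (k := k) Λ σ q) ∧
      ∀ p α, coeff α (B p) = if ∀ i ∈ s, α i = 0 then coeff α p else 0 := by
  induction s using Finset.induction_on with
  | empty => exact ⟨0, 1, 1, by simp, by simp, by simp, by simp⟩
  | insert a s ha ih =>
    obtain ⟨H, A, B, hH, hH', hHP, hB⟩ := ih
    rw [Finset.sum_insert ha]
    set D := ∑ j ∈ s, koszulTerm c j with hD
    set d := koszulTerm c a with hd
    set h : Module.End k (Λ ⊗[k] MvPolynomial σ k) := TensorProduct.map (e a) (divX k a) with hh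
    -- The defect of the one-variable homotopy `h`. It commutes with all the Koszul terms involved,
    -- so `h + ε * H` is a homotopy for the enlarged set, with defect the product of the two
    -- defects.
    set ε : Module.End k (Λ ⊗[k] MvPolynomial σ k) :=
      TensorProduct.map (c a * e a) (1 - mulX k a * divX k a) with hε
    have h1 : d * h + h * d = 1 - ε := by
      rw [hd, hh, hε, koszulTerm, ← TensorProduct.map_mul, ← TensorProduct.map_mul, divX_mul_mulX,
        eq_sub_iff_add_eq', ← add_assoc, ← TensorProduct.map_add_right, sub_add_cancel,
        ← TensorProduct.map_add_left, hce, if_pos rfl, TensorProduct.map_one]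
    have h2 : d * d = 0 := by
      rw [hd, koszulTerm, ← TensorProduct.map_mul, hsq, TensorProduct.map_zero_left]
    have h3 : ∀ j, j ≠ a → koszulTerm c j * h + h * koszulTerm c j = 0 := by
      intro j hj
      rw [hh, koszulTerm, ← TensorProduct.map_mul, ← TensorProduct.map_mul,
        divX_mul_mulX_of_ne hj.symm, ← TensorProduct.map_add_left, hce, if_neg hj,
        TensorProduct.map_zero_left]
    have h4 : ∀ j, j ≠ a → koszulTerm c j * ε = ε * koszulTerm c j := by
      intro j hj
      have e1 : c j * e a = -(e a * c j) := by
        rw [eq_neg_iff_add_eq_zero, hce, if_neg hj]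
      rw [hε, koszulTerm, ← TensorProduct.map_mul, ← TensorProduct.map_mul]
      congr 1
      · rw [← mul_assoc, hcc, neg_mul, mul_assoc, e1, mul_neg, neg_neg, mul_assoc]
      · rw [mul_sub, sub_mul, mul_one, one_mul, mul_assoc, divX_mul_mulX_of_ne hj.symm, ← mul_assoc,
          ← mul_assoc, mulX_mul_mulX]
    have hne : ∀ j ∈ s, j ≠ a := fun j hj h => ha (h ▸ hj)
    have h5 : D * h + h * D = 0 := by
      rw [hD, Finset.sum_mul, Finset.mul_sum, ← Finset.sum_add_distrib]
      exact Finset.sum_eq_zero fun j hj => h3 j (hne j hj)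
    have h6 : D * ε = ε * D := by
      rw [hD, Finset.sum_mul, Finset.mul_sum]
      exact Finset.sum_congr rfl fun j hj => h4 j (hne j hj)
    have h7 : d * H + H * d = 0 := hH' a ha
    have h8 : ε = 1 - d * h - h * d := by rw [sub_sub, h1, sub_sub_cancel]
    have h9 : d * ε = ε * d := by
      rw [h8]
      simp only [mul_sub, sub_mul, mul_one, one_mul, mul_assoc, h2, mul_zero]
      rw [← mul_assoc d d, h2, zero_mul]
      abel
    refine ⟨h + ε * H, c a * e a * A, (1 - mulX k a * divX k a) * B, ?_, ?_, ?_, ?_⟩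
    · rw [TensorProduct.map_mul]
      calc (d + D) * (h + ε * H) + (h + ε * H) * (d + D)
          = (d * h + h * d) + (D * h + h * D) + (d * ε) * H + ε * (H * d) + (D * ε) * H
            + ε * (H * D) := by noncomm_ring
        _ = (1 - ε) + ε * (d * H + H * d) + ε * (D * H + H * D) := by
            rw [h1, h5, h6, h9]; noncomm_ring
        _ = 1 - ε * TensorProduct.map A B := by rw [h7, hH, mul_zero, mul_sub, mul_one]; abel
    · intro j hj
      rw [Finset.mem_insert, not_or] at hj
      calc koszulTerm c j * (h + ε * H) + (h + ε * H) * koszulTerm c j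
          = (koszulTerm c j * h + h * koszulTerm c j) + (koszulTerm c j * ε) * H +
            ε * (H * koszulTerm c j) := by noncomm_ring
        _ = ε * (koszulTerm c j * H + H * koszulTerm c j) := by
            rw [h3 j hj.1, h4 j hj.1]; noncomm_ring
        _ = 0 := by rw [hH' j hj.2, mul_zero]
    · intro q x hx
      refine add_mem (map_mem_polyPiece (fun _ => divX_mem) hx) ?_
      have : ∀ p ∈ homogeneousSubmodule σ k q,
          (1 - mulX k a * divX k a : Module.End k (MvPolynomial σ k)) p ∈
            homogeneousSubmodule σ k q := by
        intro p hp
        refine sub_mem hp ?_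
        cases q with
        | zero =>
          have : divX k a p = 0 := by
            refine MvPolynomial.ext _ _ fun α => ?_
            change coeff α (p.divMonomial _) = 0
            rw [coeff_divMonomial]
            by_contra h0
            have := hp h0
            rw [map_add, Finsupp.weight_single] at this
            simp at this
          rw [Module.End.mul_apply, this, map_zero]
          exact zero_mem _
        | succ q => exact mulX_mem (divX_mem hp)
      exact map_mem_polyPiece this (hHP q x hx)
    · intro p α
      have key : ∀ p, coeff α ((1 - mulX k a * divX k a : Module.End k (MvPolynomial σ k)) p) =
          if α a = 0 then coeff α p else 0 := by
        intro p
        change coeff α (p - X a * p.divMonomial (Finsupp.single a 1)) = _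
        rw [coeff_sub, coeff_X_mul', coeff_divMonomial]
        by_cases h0 : α a = 0
        · rw [if_neg (by simpa using h0), if_pos h0, sub_zero]
        · rw [if_pos (by simpa using h0), if_neg h0, add_tsub_cancel_of_le, sub_self]
          simpa [Nat.one_le_iff_ne_zero] using h0
      rw [Module.End.mul_apply, key, hB]
      simp only [Finset.mem_insert, forall_eq_or_imp]
      by_cases h0 : α a = 0 <;> simp [h0]

/-- Exactness of the Koszul differential in positive degrees. -/
theorem exists_koszul_apply_eq [Fintype σ] [DecidableEq σ] (c e : σ → Module.End k Λ)
    (hsq : ∀ i, c i * c i = 0) (hce : ∀ i j, c i * e j + e j * c i = if i = j then 1 else 0)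
    (hcc : ∀ i j, c i * c j = -(c j * c i)) (q : ℕ) (x : Λ ⊗[k] MvPolynomial σ k)
    (hx : x ∈ polyPiece (k := k) Λ σ (q + 1)) (h0 : (∑ j, koszulTerm c j) x = 0) :
    ∃ y ∈ polyPiece (k := k) Λ σ q, (∑ j, koszulTerm c j) y = x := by
  obtain ⟨H, A, B, hH, -, hHP, hB⟩ := exists_koszul_homotopy c e hsq hce hcc Finset.univ
  refine ⟨H x, hHP q x hx, ?_⟩
  -- With all variables treated, `B` retains only the constant term, which is zero in degree `q +
  -- 1`.
  have h1 : polyPiece (k := k) Λ σ (q + 1) ≤ LinearMap.ker (TensorProduct.map A B) := by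
    refine Submodule.map₂_le.2 fun l _ p hp => ?_
    have : B p = 0 := by
      refine MvPolynomial.ext _ _ fun α => ?_
      rw [hB, coeff_zero]
      split_ifs with hα
      · obtain rfl : α = 0 := Finsupp.ext fun i => hα i (Finset.mem_univ i)
        by_contra h
        have := hp h
        simp at this
      · rfl
    simp [this]
  have h2 := LinearMap.congr_fun hH x
  rw [LinearMap.add_apply, LinearMap.sub_apply, Module.End.mul_apply, Module.End.mul_apply, h0,
    map_zero, add_zero, LinearMap.mem_ker.1 (h1 hx), sub_zero] at h2
  exact h2

end Koszul

/-! ### Minors of a 1-generic matrix over an algebraically closed field -/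

section Minors

open MvPolynomial

variable {k : Type*} [Field k] {V : Type*} [AddCommGroup V] [Module k V]

instance [FiniteDimensional k V] : FiniteDimensional k (ExteriorAlgebra k V) :=
  Module.Finite.of_basis (Module.finBasis k V).ExteriorAlgebra

variable (k V) in
/-- Contraction of an exterior form with a vector. -/
def contraction : V →ₗ[k] Module.End k (ExteriorAlgebra k (Module.Dual k V)) :=
  CliffordAlgebra.contractLeft ∘ₗ Module.Dual.eval k V

theorem contraction_sq (v : V) : contraction k V v * contraction k V v = 0 :=
  LinearMap.ext fun x => CliffordAlgebra.contractLeft_contractLeft _ x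

theorem contraction_anti (v w : V) :
    contraction k V v * contraction k V w = -(contraction k V w * contraction k V v) :=
  LinearMap.ext fun x => CliffordAlgebra.contractLeft_comm _ _ x

theorem contraction_one (v : V) : contraction k V v 1 = 0 :=
  CliffordAlgebra.contractLeft_one _ _

/-- Contraction is an antiderivation. For `f` in a dual family this is the relation `c e + e c = δ`
required by the Koszul homotopy. -/
theorem contraction_mulLeft (v : V) (f : Module.Dual k V) :
    contraction k V v * LinearMap.mulLeft k (ExteriorAlgebra.ι k f) +
      LinearMap.mulLeft k (ExteriorAlgebra.ι k f) * contraction k V v = f v • 1 :=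
  LinearMap.ext fun x => by
    change CliffordAlgebra.contractLeft _ (CliffordAlgebra.ι _ f * x) +
      CliffordAlgebra.ι _ f * CliffordAlgebra.contractLeft _ x = f v • x
    rw [CliffordAlgebra.contractLeft_ι_mul, sub_add_cancel]
    rfl

variable {σ : Type*}

/-- The exterior factors anticommute and the polynomial factors commute. -/
theorem koszulTerm_anti (g h : σ → V) (i j : σ)
    (x : ExteriorAlgebra k (Module.Dual k V) ⊗[k] MvPolynomial σ k) :
    koszulTerm (fun j => contraction k V (g j)) i
        (koszulTerm (fun j => contraction k V (h j)) j x) +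
      koszulTerm (fun j => contraction k V (h j)) j
        (koszulTerm (fun j => contraction k V (g j)) i x) = 0 := by
  have h1 : koszulTerm (fun j => contraction k V (g j)) i *
      koszulTerm (fun j => contraction k V (h j)) j + koszulTerm (fun j => contraction k V (h j)) j *
        koszulTerm (fun j => contraction k V (g j)) i = 0 := by
    rw [koszulTerm, koszulTerm, ← TensorProduct.map_mul, ← TensorProduct.map_mul, contraction_anti,
      mulX_mul_mulX, ← TensorProduct.map_add_left, neg_add_cancel, TensorProduct.map_zero_left]
  exact LinearMap.congr_fun h1 x

variable [Fintype σ]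

/-- The Koszul differential of a family of vectors. -/
def koszulDiff (g : σ → V) :
    Module.End k (ExteriorAlgebra k (Module.Dual k V) ⊗[k] MvPolynomial σ k) :=
  ∑ j, koszulTerm (fun j => contraction k V (g j)) j

theorem koszulDiff_apply (g : σ → V)
    (x : ExteriorAlgebra k (Module.Dual k V) ⊗[k] MvPolynomial σ k) :
    koszulDiff g x = ∑ j, koszulTerm (fun j => contraction k V (g j)) j x := by
  simp [koszulDiff]

theorem koszulDiff_mem (g : σ → V) {q : ℕ}
    {x : ExteriorAlgebra k (Module.Dual k V) ⊗[k] MvPolynomial σ k}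
    (hx : x ∈ polyPiece (k := k) (ExteriorAlgebra k (Module.Dual k V)) σ q) :
    koszulDiff g x ∈ polyPiece (k := k) (ExteriorAlgebra k (Module.Dual k V)) σ (q + 1) := by
  rw [koszulDiff_apply]
  exact sum_mem fun j _ => koszulTerm_mem _ _ hx

theorem koszulDiff_anti (g h : σ → V)
    (x : ExteriorAlgebra k (Module.Dual k V) ⊗[k] MvPolynomial σ k) :
    koszulDiff g (koszulDiff h x) = -koszulDiff h (koszulDiff g x) := by
  rw [eq_neg_iff_add_eq_zero]
  simp only [koszulDiff_apply, map_sum]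
  rw [Finset.sum_comm, ← Finset.sum_add_distrib]
  refine Finset.sum_eq_zero fun i _ => ?_
  rw [← Finset.sum_add_distrib]
  exact Finset.sum_eq_zero fun j _ => koszulTerm_anti _ _ _ _ _

/-- This does not follow from `koszulDiff_anti` in characteristic two; the diagonal terms need that
each contraction squares to zero. -/
theorem koszulDiff_sq (g : σ → V)
    (x : ExteriorAlgebra k (Module.Dual k V) ⊗[k] MvPolynomial σ k) :
    koszulDiff g (koszulDiff g x) = 0 := by
  simp only [koszulDiff_apply, map_sum]
  refine sum_alternating_eq_zero _ (fun j => ?_) fun i j => koszulTerm_anti _ _ _ _ _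
  rw [← Module.End.mul_apply, koszulTerm, ← TensorProduct.map_mul, contraction_sq,
    TensorProduct.map_zero_left, LinearMap.zero_apply]

/-- Linearity in the family of vectors: combinations of the differentials belong to combinations of
columns, where 1-genericity applies. -/
theorem sum_smul_koszulDiff {n : ℕ} (c : Fin n → k) (g : Fin n → σ → V) :
    ∑ i, c i • koszulDiff (k := k) (g i) = koszulDiff (fun j => ∑ i, c i • g i j) := by
  simp only [koszulDiff, Finset.smul_sum]
  rw [Finset.sum_comm]
  refine Finset.sum_congr rfl fun j _ => ?_
  simp only [koszulTerm, map_sum, map_smul, ← TensorProduct.map_smul_left]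
  exact (map_sum ((TensorProduct.mapBilinear (RingHom.id k) _ _ _ _).flip (mulX k j)) _ _).symm

theorem exists_koszulDiff_apply_eq (g : σ → V) (hg : LinearIndependent k g) (q : ℕ)
    (x : ExteriorAlgebra k (Module.Dual k V) ⊗[k] MvPolynomial σ k)
    (hx : x ∈ polyPiece (k := k) (ExteriorAlgebra k (Module.Dual k V)) σ (q + 1))
    (h0 : koszulDiff g x = 0) :
    ∃ y ∈ polyPiece (k := k) (ExteriorAlgebra k (Module.Dual k V)) σ q, koszulDiff g y = x := by
  classical
  obtain ⟨f, hf⟩ := (Fintype.linearCombination k g).exists_leftInverse_of_injective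
    (LinearMap.ker_eq_bot.2 (linearIndependent_iff_injective_fintypeLinearCombination.1 hg))
  refine exists_koszul_apply_eq _
    (fun j => LinearMap.mulLeft k (ExteriorAlgebra.ι k (LinearMap.proj j ∘ₗ f)))
    (fun i => contraction_sq _) (fun i j => ?_) (fun i j => contraction_anti _ _) q x hx h0
  rw [contraction_mulLeft]
  have h1 : f (g i) = Pi.single i 1 := by
    have := LinearMap.congr_fun hf (Pi.single i 1)
    simpa [Fintype.linearCombination_apply_single] using this
  rw [LinearMap.comp_apply, h1, LinearMap.proj_apply, Pi.single_apply]
  simp [eq_comm]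

theorem list_prod_map_tensor {A B : Type*} [AddCommGroup A] [Module k A] [AddCommGroup B]
    [Module k B] {n : ℕ} (f : Fin n → Module.End k A) (h : Fin n → Module.End k B) :
    (List.ofFn fun i => TensorProduct.map (f i) (h i)).prod =
      TensorProduct.map (List.ofFn f).prod (List.ofFn h).prod := by
  induction n with
  | zero => simp [TensorProduct.map_one]
  | succ n ih =>
    rw [List.ofFn_succ, List.prod_cons, ih, List.ofFn_succ, List.prod_cons, List.ofFn_succ,
      List.prod_cons, TensorProduct.map_mul]

theorem list_prod_sum {R : Type*} [Semiring R] [Algebra k R] {n : ℕ} (A : Fin n → σ → R) :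
    (List.ofFn fun i => ∑ j, A i j).prod = ∑ J : Fin n → σ, (List.ofFn fun i => A i (J i)).prod := by
  classical
  have := (MultilinearMap.mkPiAlgebraFin k n R).map_sum A
  simpa [MultilinearMap.mkPiAlgebraFin_apply] using this

theorem list_prod_koszulDiff {n : ℕ} (g : Fin n → σ → V) (l : ExteriorAlgebra k (Module.Dual k V))
    (p : MvPolynomial σ k) :
    (List.ofFn fun i => koszulDiff (k := k) (g i)).prod (l ⊗ₜ p) =
      ∑ J : Fin n → σ, (List.ofFn fun i => contraction k V (g i (J i))).prod l ⊗ₜ[k]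
        ((∏ i, X (J i)) * p) := by
  simp only [koszulDiff]
  rw [list_prod_sum (k := k), LinearMap.sum_apply]
  refine Finset.sum_congr rfl fun J _ => ?_
  simp only [koszulTerm]
  rw [list_prod_map_tensor, TensorProduct.map_tmul]
  congr 1
  have := map_list_prod (Algebra.lmul k (MvPolynomial σ k)) (List.ofFn fun i => X (J i))
  rw [List.map_ofFn, List.prod_ofFn] at this
  exact (LinearMap.congr_fun this p).symm

/-- The expansion of an alternating form on vectors of linear forms in terms of minors. -/
theorem sum_alternating_mem_span_minors {m : Type*} [LinearOrder m] [Fintype m]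
    (b : Module.Basis m k V) {n : ℕ} (L : ⋀[k]^n V →ₗ[k] k) (g : Fin n → σ → V) :
    ∑ J : Fin n → σ, L (exteriorPower.ιMulti k n fun i => g i (J i)) • ∏ i, X (J i) ∈
      Submodule.span k {x : MvPolynomial σ k | ∃ r : Fin n ↪ m,
        x = (Matrix.of fun i t => ∑ j, C (b.coord (r t) (g i j)) * X j).det} := by
  classical
  -- Expansion along the basis of `⋀^n V` induced by `b`: the coordinates of a decomposable vector
  -- are minors of its coordinate matrix.
  have h1 : ∀ v : Fin n → V, L (exteriorPower.ιMulti k n v) =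
      ∑ s, (Matrix.of fun i t => b.coord (Set.powersetCard.ofFinEmbEquiv.symm s t) (v i)).det *
        L (b.exteriorPower n s) := by
    intro v
    conv_lhs => rw [← (b.exteriorPower n).sum_repr (exteriorPower.ιMulti k n v)]
    simp only [map_sum, map_smul, smul_eq_mul, exteriorPower.basis_repr_apply,
      exteriorPower.ιMultiDual_apply_ιMulti]
  -- Multilinearity of the determinant in its rows, each of which is a sum over the variables.
  have h2 : ∀ r : Fin n → m,
      (Matrix.of fun i t => ∑ j, C (b.coord (r t) (g i j)) * X j : Matrix _ _ (MvPolynomial σ k)).det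
        = ∑ J : Fin n → σ,
          (Matrix.of fun i t => b.coord (r t) (g i (J i))).det • ∏ i, X (J i) := by
    intro r
    have := (Matrix.detRowAlternating (n := Fin n) (R := MvPolynomial σ k)).toMultilinearMap.map_sum
      (fun i (j : σ) => (X j : MvPolynomial σ k) • fun t => C (b.coord (r t) (g i j)))
    have e : (fun i => ∑ j : σ, (X j : MvPolynomial σ k) • fun t => (C (b.coord (r t) (g i j)) :
        MvPolynomial σ k)) = fun i t => ∑ j, C (b.coord (r t) (g i j)) * X j := by
      funext i t
      simp [mul_comm]
    rw [e] at this
    refine this.trans (Finset.sum_congr rfl fun J _ => ?_)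
    refine ((Matrix.detRowAlternating (n := Fin n)
      (R := MvPolynomial σ k)).toMultilinearMap.map_smul_univ (fun i => X (J i))
      (fun i t => C (b.coord (r t) (g i (J i))))).trans ?_
    rw [smul_eq_mul, mul_comm, ← C_mul', RingHom.map_det]
    rfl
  simp only [h1, Finset.sum_smul]
  rw [Finset.sum_comm]
  refine sum_mem fun s _ => ?_
  have : ∑ J : Fin n → σ,
      ((Matrix.of fun i t => b.coord (Set.powersetCard.ofFinEmbEquiv.symm s t) (g i (J i))).det *
        L (b.exteriorPower n s)) • ∏ i, (X (J i) : MvPolynomial σ k) =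
      L (b.exteriorPower n s) • (Matrix.of fun i t => ∑ j,
        C (b.coord (Set.powersetCard.ofFinEmbEquiv.symm s t) (g i j)) * X j :
          Matrix _ _ (MvPolynomial σ k)).det := by
    rw [h2, Finset.smul_sum]
    exact Finset.sum_congr rfl fun J _ => by rw [smul_smul, mul_comm]
  rw [this]
  exact Submodule.smul_mem _ _ (Submodule.subset_span
    ⟨(Set.powersetCard.ofFinEmbEquiv.symm s).toEmbedding, rfl⟩)

/-- The maximal minors of a `1`-generic matrix of linear forms with `n` columns over an
algebraically closed field span all forms of degree `n`. -/
theorem homogeneousSubmodule_le_span_minors [IsAlgClosed k] [FiniteDimensional k V] {m : Type*}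
    [LinearOrder m] [Fintype m] (b : Module.Basis m k V) {n : ℕ} (g : Fin n → σ → V)
    (hg : ∀ c : Fin n → k, c ≠ 0 → LinearIndependent k fun j => ∑ i, c i • g i j) :
    homogeneousSubmodule σ k n ≤
      Submodule.span k {x : MvPolynomial σ k | ∃ r : Fin n ↪ m,
        x = (Matrix.of fun i t => ∑ j, C (b.coord (r t) (g i j)) * X j).det} := by
  intro p hp
  -- Contractions kill `1`, so `1 ⊗ p` lies in every kernel. Since `p` has degree exactly `n`, the
  -- preimage under the product has polynomial degree `0`.
  obtain ⟨y, hy, hy'⟩ := exists_prod_apply_of_exact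
    (polyPiece (k := k) (ExteriorAlgebra k (Module.Dual k V)) σ)
    (fun i => koszulDiff (k := k) (g i)) (fun i x => koszulDiff_sq (g i) x)
    (fun i j x => koszulDiff_anti (g i) (g j) x)
    (fun i q x hx => koszulDiff_mem _ hx)
    (fun c hc q x hx h0 => by
      rw [sum_smul_koszulDiff] at h0 ⊢
      exact exists_koszulDiff_apply_eq _ (hg c hc) q x hx h0)
    0 (1 ⊗ₜ p) (tmul_mem_polyPiece 1 (by rwa [zero_add]))
    (fun i => by
      rw [koszulDiff_apply]
      exact Finset.sum_eq_zero fun j _ => by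
        rw [koszulTerm, TensorProduct.map_tmul, contraction_one, TensorProduct.zero_tmul])
  set M := Submodule.span k {x : MvPolynomial σ k | ∃ r : Fin n ↪ m,
        x = (Matrix.of fun i t => ∑ j, C (b.coord (r t) (g i j)) * X j).det} with hM
  -- The scalar component of the exterior factor; it recovers `p` from `1 ⊗ p`.
  let E : ExteriorAlgebra k (Module.Dual k V) ⊗[k] MvPolynomial σ k →ₗ[k] MvPolynomial σ k :=
    (TensorProduct.lid k _).toLinearMap ∘ₗ
      (ExteriorAlgebra.algebraMapInv (M := Module.Dual k V)).toLinearMap.rTensor _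
  have hE : E (1 ⊗ₜ p) = p := by simp [E]
  rw [← hE, ← hy']
  have key : polyPiece (k := k) (ExteriorAlgebra k (Module.Dual k V)) σ 0 ≤
      M.comap (E ∘ₗ (List.ofFn fun i => koszulDiff (k := k) (g i)).prod) := by
    refine Submodule.map₂_le.2 fun l _ f hf => ?_
    rw [homogeneousSubmodule_zero, Submodule.mem_one] at hf
    obtain ⟨r, rfl⟩ := hf
    rw [Submodule.mem_comap, LinearMap.comp_apply, TensorProduct.mk_apply, list_prod_koszulDiff,
      map_sum]
    -- Contractions square to zero, so iterated contraction of `l` extends to `⋀ V`; its scalar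
    -- component is a linear form on `⋀^n V`, rescaled by the constant polynomial `r`.
    let L : ⋀[k]^n V →ₗ[k] k := r • ((ExteriorAlgebra.algebraMapInv).toLinearMap ∘ₗ
      (LinearMap.applyₗ l) ∘ₗ (ExteriorAlgebra.lift k
        ⟨contraction k V, contraction_sq⟩).toLinearMap ∘ₗ (⋀[k]^n V).subtype)
    have hL : ∀ v : Fin n → V, L (exteriorPower.ιMulti k n v) =
        r * ExteriorAlgebra.algebraMapInv ((List.ofFn fun i => contraction k V (v i)).prod l) := by
      intro v
      change r * ExteriorAlgebra.algebraMapInv ((ExteriorAlgebra.lift k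
        ⟨contraction k V, contraction_sq⟩ (ExteriorAlgebra.ιMulti k n v)) l) = _
      rw [ExteriorAlgebra.ιMulti_apply, map_list_prod, List.map_ofFn]
      congr 4
      exact congrArg List.ofFn (funext fun i => ExteriorAlgebra.lift_ι_apply ..)
    refine (congrArg (· ∈ M) (Finset.sum_congr rfl fun J _ => ?_)).mpr
      (sum_alternating_mem_span_minors b L g)
    rw [hL]
    simp only [E, LinearMap.comp_apply, LinearMap.rTensor_tmul, LinearEquiv.coe_coe,
      TensorProduct.lid_tmul, AlgHom.toLinearMap_apply]
    rw [Algebra.algebraMap_eq_smul_one, mul_smul_comm, mul_one, smul_smul, mul_comm]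
  exact key hy

end Minors

/-! ### Descent from the algebraic closure, and passage to `Sym(U^*)` -/

section Descent

open MvPolynomial

/-- Membership in a span of polynomials can be tested after a field extension. -/
theorem mem_span_of_map_mem_span {k K σ : Type*} [Field k] [Field K] [Algebra k K]
    {S : Set (MvPolynomial σ k)} {p : MvPolynomial σ k}
    (h : MvPolynomial.map (algebraMap k K) p ∈
      Submodule.span K (MvPolynomial.map (algebraMap k K) '' S)) :
    p ∈ Submodule.span k S := by
  by_contra hp
  obtain ⟨φ, hφp, hφ⟩ := Submodule.exists_le_ker_of_notMem hp
  -- The `K`-linear extension of a functional over `k` that separates `p` from `S`; it separates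
  -- their images over `K` as well.
  let ψ : MvPolynomial σ K →ₗ[K] K :=
    (basisMonomials σ K).constr K fun α => algebraMap k K (φ (monomial α 1))
  have hψ : ∀ q, ψ (MvPolynomial.map (algebraMap k K) q) = algebraMap k K (φ q) := by
    intro q
    induction q using MvPolynomial.induction_on' with
    | add q r hq hr => simp only [map_add, hq, hr]
    | monomial α a =>
      have e1 : monomial α (algebraMap k K a) = algebraMap k K a • monomial α 1 := by
        rw [smul_monomial, smul_eq_mul, mul_one]
      have e2 : monomial α a = a • monomial α 1 := by rw [smul_monomial, smul_eq_mul, mul_one]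
      rw [map_monomial, e1, e2, map_smul, map_smul, smul_eq_mul, smul_eq_mul, map_mul]
      congr 1
      have := (basisMonomials σ K).constr_basis K (fun α => algebraMap k K (φ (monomial α 1))) α
      rwa [coe_basisMonomials] at this
  have : Submodule.span K (MvPolynomial.map (algebraMap k K) '' S) ≤ LinearMap.ker ψ := by
    rw [Submodule.span_le]
    rintro _ ⟨q, hq, rfl⟩
    have : φ q = 0 := hφ (Submodule.subset_span hq)
    change ψ _ = 0
    rw [hψ, this, map_zero]
  have h0 := this h
  rw [LinearMap.mem_ker, hψ, map_eq_zero] at h0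
  exact hφp h0

variable {k : Type*} [Field k] {U V W : Type*} [AddCommGroup U] [Module k U]
  [AddCommGroup V] [Module k V] [AddCommGroup W] [Module k W]

theorem closurePairing_tmul (μ : W ⊗[k] U →ₗ[k] V) (a : W) (b : U) :
    closurePairing μ ((1 ⊗ₜ a) ⊗ₜ (1 ⊗ₜ b)) = 1 ⊗ₜ μ (a ⊗ₜ b) := by
  rw [closurePairing, LinearMap.comp_apply]
  have : (TensorProduct.AlgebraTensorModule.distribBaseChange k (AlgebraicClosure k) W U).symm
      ((1 ⊗ₜ a) ⊗ₜ (1 ⊗ₜ b)) = 1 ⊗ₜ[k] (a ⊗ₜ[k] b) := by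
    rw [LinearEquiv.symm_apply_eq]
    simp
  rw [LinearEquiv.coe_coe, this, LinearMap.baseChange_tmul]

/-- Over the algebraic closure, a relation with nonzero coefficients `β` among the vectors of a
column combination `α ≠ 0` would give `μ(a ⊗ b) = 0` for the nonzero `a`, `b` with coordinates `α`,
`β`. So the spanning theorem applies there. All the minors are defined over `k`, hence the span
descends. -/
theorem homogeneousSubmodule_le_span_minors_of_isGeometricallyOneGeneric [FiniteDimensional k V]
    {μ : W ⊗[k] U →ₗ[k] V} (hμ : IsGeometricallyOneGeneric μ) {l m σ : Type*} [Fintype σ]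
    [LinearOrder m] [Fintype m] (bW : Module.Basis l k W) (bV : Module.Basis m k V)
    (bU : Module.Basis σ k U) {n : ℕ} (c : Fin n ↪ l) :
    homogeneousSubmodule σ k n ≤
      Submodule.span k {x : MvPolynomial σ k | ∃ r : Fin n ↪ m, x = (Matrix.of fun i t =>
        ∑ j, C (bV.coord (r t) (μ (bW (c i) ⊗ₜ bU j))) * X j).det} := by
  intro p hp
  let K := AlgebraicClosure k
  let g : Fin n → σ → K ⊗[k] V := fun i j => 1 ⊗ₜ μ (bW (c i) ⊗ₜ bU j)
  have hg : ∀ α : Fin n → K, α ≠ 0 → LinearIndependent K fun j => ∑ i, α i • g i j := by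
    intro α hα
    rw [Fintype.linearIndependent_iff]
    intro β hβ
    by_contra hne
    refine hμ (∑ i, α i • ((1 : K) ⊗ₜ[k] bW (c i))) (∑ j, β j • ((1 : K) ⊗ₜ[k] bU j)) ?_ ?_ ?_
    · intro h0
      apply hα
      have h1 := ((Algebra.TensorProduct.basis K bW).linearIndependent.comp c c.injective)
      rw [Fintype.linearIndependent_iff] at h1
      exact funext (h1 α (by simpa using h0))
    · intro h0
      have h1 := (Algebra.TensorProduct.basis K bU).linearIndependent
      rw [Fintype.linearIndependent_iff] at h1
      exact hne (h1 β (by simpa using h0))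
    · rw [← hβ]
      simp only [TensorProduct.sum_tmul, TensorProduct.tmul_sum, map_sum, Finset.smul_sum]
      refine Finset.sum_congr rfl fun j _ => Finset.sum_congr rfl fun i _ => ?_
      rw [← TensorProduct.smul_tmul', TensorProduct.tmul_smul, map_smul, map_smul,
        closurePairing_tmul, smul_comm]
  have h1 := homogeneousSubmodule_le_span_minors (Algebra.TensorProduct.basis K bV) g hg
    (show MvPolynomial.map (algebraMap k K) p ∈ homogeneousSubmodule σ K n from
      IsHomogeneous.map hp _)
  refine mem_span_of_map_mem_span (Submodule.span_mono ?_ h1)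
  rintro _ ⟨r, rfl⟩
  refine ⟨_, ⟨r, rfl⟩, ?_⟩
  rw [RingHom.map_det]
  congr 1
  ext1 i t
  simp [g, Algebra.TensorProduct.basis_repr_tmul, Algebra.algebraMap_eq_smul_one]

theorem equivMvPolynomial_mem {M σ : Type*} [AddCommGroup M] [Module k M]
    (b : Module.Basis σ k M) {n : ℕ} {s : SymmetricAlgebra k M} (hs : s ∈ symPower k M n) :
    SymmetricAlgebra.equivMvPolynomial b s ∈ homogeneousSubmodule σ k n := by
  induction n generalizing s with
  | zero =>
    obtain ⟨r, rfl⟩ : ∃ r : k, algebraMap k _ r = s := by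
      simpa [symPower, Submodule.mem_one] using hs
    rw [AlgEquiv.commutes]
    exact isHomogeneous_C _ _
  | succ n ih =>
    rw [symPower, pow_succ] at hs
    induction hs using Submodule.mul_induction_on' with
    | mem_mul_mem s hs t ht =>
      obtain ⟨m, rfl⟩ := ht
      rw [map_mul]
      refine (ih hs).mul ?_
      have : ⊤ ≤ (homogeneousSubmodule σ k 1).comap
          ((SymmetricAlgebra.equivMvPolynomial b).toLinearMap ∘ₗ SymmetricAlgebra.ι k M) := by
        rw [← b.span_eq, Submodule.span_le]
        rintro _ ⟨i, rfl⟩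
        rw [SetLike.mem_coe, Submodule.mem_comap, LinearMap.comp_apply,
          AlgEquiv.toLinearMap_apply, SymmetricAlgebra.equivMvPolynomial_ι_apply]
        exact isHomogeneous_X k i
      exact this trivial
    | add s _ t _ hs ht => rw [map_add]; exact add_mem hs ht

theorem equivMvPolynomial_linearMatrix {l m σ : Type*} [Fintype σ] [DecidableEq σ]
    (bW : Module.Basis l k W) (bV : Module.Basis m k V)
    (bU : Module.Basis σ k U) (μ : W ⊗[k] U →ₗ[k] V) (i : m) (j : l) :
    SymmetricAlgebra.equivMvPolynomial bU.dualBasis (linearMatrix bW bV μ i j) =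
      ∑ t, C (bV.coord i (μ (bW j ⊗ₜ bU t))) * X t := by
  have : ∀ f : Module.Dual k U, f = ∑ t, f (bU t) • bU.dualBasis t := fun f => by
    refine bU.ext fun s => ?_
    simp
  rw [linearMatrix, Matrix.of_apply, this (bV.coord i ∘ₗ _)]
  simp only [map_sum, map_smul, SymmetricAlgebra.equivMvPolynomial_ι_apply, C_mul']
  rfl

theorem det_mem_symPower {M : Type*} [AddCommGroup M] [Module k M] {n : ℕ}
    (A : Matrix (Fin n) (Fin n) (SymmetricAlgebra k M)) (hA : ∀ i j, A i j ∈ symPower k M 1) :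
    A.det ∈ symPower k M n := by
  rw [Matrix.det_apply]
  refine sum_mem fun τ _ => ?_
  rw [Units.smul_def]
  refine zsmul_mem ?_ _
  have : ∀ (n : ℕ) (f : Fin n → SymmetricAlgebra k M), (∀ i, f i ∈ symPower k M 1) →
      ∏ i, f i ∈ symPower k M n := by
    intro n
    induction n with
    | zero => exact fun f _ => by simp [symPower]
    | succ n ih =>
      intro f hf
      have := symPower_mul_mem (hf 0) (ih _ fun i => hf i.succ)
      rwa [add_comm 1 n, ← Fin.prod_univ_succ] at this
  exact this n _ fun i => hA _ _

variable [FiniteDimensional k U] [FiniteDimensional k V]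

/-- The minors with a fixed set of columns span all forms. -/
theorem symPower_le_span_minors {μ : W ⊗[k] U →ₗ[k] V} (hμ : IsGeometricallyOneGeneric μ)
    {l m : Type*} [LinearOrder m] [Fintype m] (bW : Module.Basis l k W) (bV : Module.Basis m k V)
    {n : ℕ} (c : Fin n ↪ l) :
    symPower k (Module.Dual k U) n ≤ Submodule.span k
      {x | ∃ r : Fin n ↪ m, x = ((linearMatrix bW bV μ).submatrix r c).det} := by
  classical
  intro s hs
  set e := SymmetricAlgebra.equivMvPolynomial (Module.finBasis k U).dualBasis with he
  have h1 := homogeneousSubmodule_le_span_minors_of_isGeometricallyOneGeneric hμ bW bV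
    (Module.finBasis k U) c (equivMvPolynomial_mem (Module.finBasis k U).dualBasis hs)
  have h2 : {x : MvPolynomial _ k | ∃ r : Fin n ↪ m, x = (Matrix.of fun i t =>
        ∑ j, C (bV.coord (r t) (μ (bW (c i) ⊗ₜ Module.finBasis k U j))) * X j).det} =
      e.toLinearMap '' {x | ∃ r : Fin n ↪ m, x = ((linearMatrix bW bV μ).submatrix r c).det} := by
    have h3 : ∀ r : Fin n ↪ m, (Matrix.of fun i t =>
        ∑ j, C (bV.coord (r t) (μ (bW (c i) ⊗ₜ Module.finBasis k U j))) * X j).det =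
        e (((linearMatrix bW bV μ).submatrix r c).det) := by
      intro r
      -- The Koszul argument indexes rows by the chosen vectors of `W`, whereas `linearMatrix`
      -- indexes columns by them.
      rw [← Matrix.det_transpose, AlgEquiv.map_det]
      congr 1
      ext1 i t
      exact (equivMvPolynomial_linearMatrix bW bV (Module.finBasis k U) μ (r i) (c t)).symm
    ext x
    constructor
    · rintro ⟨r, rfl⟩
      exact ⟨_, ⟨r, rfl⟩, (h3 r).symm⟩
    · rintro ⟨_, ⟨r, rfl⟩, rfl⟩
      exact ⟨r, (h3 r).symm⟩
  rw [h2, ← Submodule.map_span] at h1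
  obtain ⟨t, ht, hts⟩ := h1
  rwa [← e.injective hts]

/-- The minors in one fixed set of columns already span, so the existence of some `n` columns is all
that is needed; the opposite inclusion is a matter of degrees. -/
theorem minorSpan_eq_symPower {μ : W ⊗[k] U →ₗ[k] V} (hμ : IsGeometricallyOneGeneric μ)
    {l m : Type*} [LinearOrder m] [Fintype m] (bW : Module.Basis l k W) (bV : Module.Basis m k V)
    {n : ℕ} (c : Fin n ↪ l) :
    minorSpan k (linearMatrix bW bV μ) n = symPower k (Module.Dual k U) n := by
  apply le_antisymm
  · rw [minorSpan, Submodule.span_le]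
    rintro _ ⟨r, c, rfl⟩
    exact det_mem_symPower _ fun i j => ι_mem_symPower _
  · refine (symPower_le_span_minors hμ bW bV c).trans (Submodule.span_mono ?_)
    rintro _ ⟨r, rfl⟩
    exact ⟨r, c, rfl⟩

end Descent

/-! ### Degrees and factorization for graded complexes -/

section Graded

variable {k : Type u} {V : Type v} [Field k] [AddCommGroup V] [Module k V]

theorem iSup_ne_disjoint {M : Type*} [AddCommGroup M] [Module k M] {deg : ℤ → Submodule k M}
    (h : DirectSum.IsInternal deg) {n : ℤ} {x : M} (hx : x ∈ deg n)
    (hx' : x ∈ ⨆ (m) (_ : m ≠ n), deg m) : x = 0 :=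
  Submodule.disjoint_def.1 (h.submodule_iSupIndep n) x hx hx'

/-- An injective homogeneous map reflects degrees. -/
theorem mem_of_apply_mem {M M' : Type*} [AddCommGroup M] [Module k M] [AddCommGroup M']
    [Module k M'] {deg : ℤ → Submodule k M} {deg' : ℤ → Submodule k M'}
    (h : DirectSum.IsInternal deg) (h' : DirectSum.IsInternal deg') (f : M →ₗ[k] M')
    (hf : Function.Injective f) (hd : ∀ n, ∀ x ∈ deg n, f x ∈ deg' n) {n : ℤ} {x : M}
    (hx : f x ∈ deg' n) : x ∈ deg n := by
  have hx0 : x ∈ ⨆ m, deg m := h.submodule_iSup_eq_top ▸ trivial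
  rw [iSup_split_single deg n] at hx0
  obtain ⟨y, hy, z, hz, rfl⟩ := Submodule.mem_sup.1 hx0
  have h1 : f z ∈ deg' n := by
    have := sub_mem hx (hd n y hy)
    rwa [map_add, add_sub_cancel_left] at this
  have h2 : f z ∈ ⨆ (m) (_ : m ≠ n), deg' m := by
    have : ⨆ (m) (_ : m ≠ n), deg m ≤ (⨆ (m) (_ : m ≠ n), deg' m).comap f :=
      iSup₂_le fun m hm x hx => Submodule.mem_iSup_of_mem m (Submodule.mem_iSup_of_mem hm (hd m x hx))
    exact this hz
  have h3 : z = 0 := hf ((iSup_ne_disjoint h' h1 h2).trans (map_zero f).symm)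
  rw [h3, add_zero]
  exact hy

namespace GradedComplex

variable (F : GradedComplex.{u, v, w} k V)

/-- The part of degree at least `N` of the `i`-th module of a complex. -/
def tail (i N : ℤ) : Submodule k (F.X i) := ⨆ (n) (_ : N ≤ n), F.deg i n

variable {F}

theorem mem_tail {i N n : ℤ} (h : N ≤ n) {x : F.X i} (hx : x ∈ F.deg i n) : x ∈ F.tail i N :=
  Submodule.mem_iSup_of_mem n (Submodule.mem_iSup_of_mem h hx)

theorem smul_mem_tail_of_mem {i N : ℤ} {a : ℕ} {s : SymmetricAlgebra k V} (hs : s ∈ symPower k V a)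
    {x : F.X i} (hx : x ∈ F.tail i N) : s • x ∈ F.tail i (N + a) := by
  have : F.tail i N ≤ (F.tail i (N + a)).comap (Algebra.lsmul k k (F.X i) s) :=
    iSup₂_le fun n hn x hx => mem_tail (n := n + a) (by omega) (F.smul_mem i n a s x hs hx)
  exact this hx

theorem smul_mem_tail {i N : ℤ} (s : SymmetricAlgebra k V) {x : F.X i} (hx : x ∈ F.tail i N) :
    s • x ∈ F.tail i N := by
  have hs : s ∈ ⨆ n, symPower k V n := iSup_symPower (k := k) (M := V) ▸ trivial
  induction hs using Submodule.iSup_induction' with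
  | zero => rw [zero_smul]; exact zero_mem _
  | add s t _ _ hs ht => rw [add_smul]; exact add_mem hs ht
  | mem a s hs =>
    have : F.tail i (N + a) ≤ F.tail i N := iSup₂_le fun n hn x hx => mem_tail (by omega) hx
    exact this (smul_mem_tail_of_mem hs hx)

/-- The module is generated in degree `i`, so it lives in degrees at least `i`, and multiplication
by an element of `V` raises the degree by one. -/
theorem maxIdeal_smul_le_tail {i : ℤ} (hF : F.IsStandardLinearFree) {x : F.X i}
    (hx : x ∈ (maxIdeal k V • ⊤ : Submodule (SymmetricAlgebra k V) (F.X i))) :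
    x ∈ F.tail i (i + 1) := by
  have htop : ∀ x : F.X i, x ∈ F.tail i i := by
    obtain ⟨B, hB, -, hspan⟩ := hF.2 i
    intro x
    have hx : x ∈ Submodule.span (SymmetricAlgebra k V) B := hspan ▸ trivial
    induction hx using Submodule.span_induction with
    | zero => exact zero_mem _
    | add x y _ _ hx hy => exact add_mem hx hy
    | smul s x _ hx => exact smul_mem_tail s hx
    | mem x hx => exact mem_tail le_rfl (hB hx)
  induction hx using Submodule.smul_induction_on' with
  | add x _ y _ hx hy => exact add_mem hx hy
  | smul r hr x _ =>
    rw [maxIdeal] at hr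
    induction hr using Submodule.span_induction with
    | zero => rw [zero_smul]; exact zero_mem _
    | add r s _ _ hr hs => rw [add_smul]; exact add_mem hr hs
    | smul s r _ hr => rw [smul_assoc]; exact smul_mem_tail s hr
    | mem r hr =>
      obtain ⟨v, rfl⟩ := hr
      exact smul_mem_tail_of_mem (a := 1) (ι_mem_symPower v) (htop x)

/-- The generators of a standard linear free complex have no component in `𝔪 F_i`. -/
theorem eq_zero_of_mem_maxIdeal_smul (hF : F.IsStandardLinearFree) {i : ℤ} {x : F.X i}
    (hx : x ∈ F.deg i i)
    (hx' : x ∈ (maxIdeal k V • ⊤ : Submodule (SymmetricAlgebra k V) (F.X i))) : x = 0 := by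
  refine iSup_ne_disjoint (F.isInternal i) hx ?_
  have : F.tail i (i + 1) ≤ ⨆ (m) (_ : m ≠ i), F.deg i m := iSup₂_le fun n hn x hx =>
    Submodule.mem_iSup_of_mem n (Submodule.mem_iSup_of_mem (by omega) hx)
  exact this (maxIdeal_smul_le_tail hF hx')

/-- A surjective map of complexes whose kernel is contained in the kernel of `ρ`, and which is
surjective in every degree, is a map through which `ρ` factors. -/
theorem exists_factor {F' G : GradedComplex.{u, v, w} k V} (π : Hom F F') (ρ : Hom F G)
    (hker : ∀ i x, π.f i x = 0 → ρ.f i x = 0)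
    (hdeg : ∀ i n, ∀ x ∈ F'.deg i n, ∃ y ∈ F.deg i n, π.f i y = x)
    (hsurj : ∀ i, Function.Surjective (π.f i)) :
    ∃ σ : Hom F' G, ∀ i, ρ.f i = σ.f i ∘ₗ π.f i := by
  choose s hs using hsurj
  have hρ : ∀ i x y, π.f i x = π.f i y → ρ.f i x = ρ.f i y := fun i x y h => by
    rw [← sub_eq_zero, ← map_sub]
    exact hker i _ (by rw [map_sub, h, sub_self])
  let σ : ∀ i, F'.X i →ₗ[SymmetricAlgebra k V] G.X i := fun i =>
    { toFun := fun x => ρ.f i (s i x)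
      map_add' := fun x y => by
        rw [← map_add]
        exact hρ i _ _ (by rw [map_add, hs, hs, hs])
      map_smul' := fun c x => by
        rw [RingHom.id_apply, ← map_smul]
        exact hρ i _ _ (by rw [map_smul, hs, hs]) }
  have hσ : ∀ i x, σ i (π.f i x) = ρ.f i x := fun i x => hρ i _ _ (hs i _)
  refine ⟨⟨σ, fun i n x hx => ?_, fun i x => ?_⟩, fun i => LinearMap.ext fun x => (hσ i x).symm⟩
  · obtain ⟨y, hy, rfl⟩ := hdeg i n x hx
    rw [hσ]
    exact ρ.deg_mem i n y hy
  · obtain ⟨y, rfl⟩ : ∃ y, π.f i y = x := ⟨s i x, hs i x⟩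
    rw [← π.comm, hσ, hσ, ρ.comm]

/-- Two maximal irredundant quotients have the same kernels. -/
theorem IsMaximalIrredundantQuotient.apply_eq_zero {F' F'' : GradedComplex.{u, v, w} k V}
    {π : Hom F F'} {π' : Hom F F''} (h : IsMaximalIrredundantQuotient π)
    (h' : IsMaximalIrredundantQuotient π') {i : ℤ} {x : F.X i} (hx : π.f i x = 0) :
    π'.f i x = 0 := by
  obtain ⟨σ, hσ⟩ := h.factors _ π' h'.surjective h'.linearFree h'.irredundant
  rw [hσ, LinearMap.comp_apply, hx, map_zero]

end GradedComplex

end Graded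

/-! ### Free modules `S ⊗ T` -/

section FreeModule

variable {k : Type u} {V : Type v} [Field k] [AddCommGroup V] [Module k V]
  {T : Type w} [AddCommGroup T] [Module k T]

theorem exists_basis_freeDeg (i : ℤ) : ∃ B : Set (SymmetricAlgebra k V ⊗[k] T),
    B ⊆ freeDeg k V T i i ∧ LinearIndepOn (SymmetricAlgebra k V) id B ∧
      Submodule.span (SymmetricAlgebra k V) B = ⊤ := by
  let b := Algebra.TensorProduct.basis (SymmetricAlgebra k V) (Module.Basis.ofVectorSpace k T)
  refine ⟨Set.range b, ?_, b.linearIndependent.linearIndepOn_id, b.span_eq⟩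
  rintro _ ⟨t, rfl⟩
  rw [Algebra.TensorProduct.basis_apply]
  refine tmul_mem_freeDeg (a := 0) ?_ _ (by simp)
  rw [symPower, pow_zero]
  exact Submodule.one_le.1 le_rfl

theorem ι_mem_maxIdeal (v : V) : SymmetricAlgebra.ι k V v ∈ maxIdeal k V :=
  Ideal.subset_span ⟨v, rfl⟩

theorem sub_algebraMap_mem_maxIdeal (s : SymmetricAlgebra k V) :
    s - algebraMap k _ (SymmetricAlgebra.algebraMapInv s) ∈ maxIdeal k V := by
  induction s using SymmetricAlgebra.induction with
  | algebraMap r => rw [AlgHom.commutes, Algebra.algebraMap_self, RingHom.id_apply, sub_self]; exact zero_mem _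
  | ι v =>
    rw [SymmetricAlgebra.algebraMapInv_ι, map_zero, sub_zero]
    exact ι_mem_maxIdeal v
  | mul a b ha hb =>
    rw [map_mul, map_mul]
    have := add_mem (Ideal.mul_mem_left _ a hb) (Ideal.mul_mem_right
      (algebraMap k _ (SymmetricAlgebra.algebraMapInv b)) _ ha)
    convert this using 1
    ring
  | add a b ha hb =>
    rw [map_add, map_add, add_sub_add_comm]
    exact add_mem ha hb

theorem tmul_mem_ideal_smul {I : Ideal (SymmetricAlgebra k V)} {s : SymmetricAlgebra k V}
    (hs : s ∈ I) (t : T) :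
    s ⊗ₜ[k] t ∈ (I • ⊤ : Submodule (SymmetricAlgebra k V) (SymmetricAlgebra k V ⊗[k] T)) := by
  have := Submodule.smul_mem_smul hs
    (Submodule.mem_top : (1 : SymmetricAlgebra k V) ⊗ₜ[k] t ∈ (⊤ : Submodule (SymmetricAlgebra k V) _))
  rwa [TensorProduct.smul_tmul', smul_eq_mul, mul_one] at this

/-- Every element of `S ⊗ T` is congruent to an element of `T` modulo `𝔪`. -/
theorem exists_sub_one_tmul_mem (x : SymmetricAlgebra k V ⊗[k] T) :
    ∃ t : T, x - 1 ⊗ₜ t ∈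
      (maxIdeal k V • ⊤ : Submodule (SymmetricAlgebra k V) (SymmetricAlgebra k V ⊗[k] T)) := by
  induction x using TensorProduct.induction_on with
  | zero => exact ⟨0, by simp⟩
  | add x y hx hy =>
    obtain ⟨s, hs⟩ := hx
    obtain ⟨t, ht⟩ := hy
    refine ⟨s + t, ?_⟩
    rw [TensorProduct.tmul_add, add_sub_add_comm]
    exact add_mem hs ht
  | tmul s t =>
    refine ⟨SymmetricAlgebra.algebraMapInv s • t, ?_⟩
    rw [← TensorProduct.smul_tmul, ← TensorProduct.sub_tmul, ← Algebra.algebraMap_eq_smul_one]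
    exact tmul_mem_ideal_smul (sub_algebraMap_mem_maxIdeal s) t

/-- The linear coefficient of an element of `Sym(V)` along a functional on `V`. -/
def linCoeff (e : Module.Dual k V) : SymmetricAlgebra k V →ₗ[k] k :=
  TrivSqZeroExt.sndHom k k ∘ₗ
    (SymmetricAlgebra.lift (TrivSqZeroExt.inrHom k k ∘ₗ e)).toLinearMap

theorem linCoeff_ι (e : Module.Dual k V) (v : V) : linCoeff e (SymmetricAlgebra.ι k V v) = e v := by
  simp [linCoeff]

/-- The algebra map `v ↦ e(v) ε` to the dual numbers sends `𝔪` into the ideal generated by `ε`,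
whose square is zero. -/
theorem linCoeff_of_mem (e : Module.Dual k V) {s : SymmetricAlgebra k V}
    (hs : s ∈ maxIdeal k V ^ 2) : linCoeff e s = 0 := by
  have h1 : ∀ s ∈ maxIdeal k V,
      (SymmetricAlgebra.lift (TrivSqZeroExt.inrHom k k ∘ₗ e) s).fst = 0 := by
    have : maxIdeal k V ≤ RingHom.ker ((TrivSqZeroExt.fstHom k k k).toRingHom.comp
        (SymmetricAlgebra.lift (TrivSqZeroExt.inrHom k k ∘ₗ e)).toRingHom) := by
      rw [maxIdeal, Ideal.span_le]
      rintro _ ⟨v, rfl⟩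
      simp [RingHom.mem_ker]
    exact this
  rw [pow_two] at hs
  induction hs using Submodule.mul_induction_on' with
  | mem_mul_mem a ha b hb =>
    simp [linCoeff, TrivSqZeroExt.snd_mul, h1 a ha, h1 b hb]
  | add a _ b _ ha hb => rw [map_add, ha, hb, add_zero]

/-- If `∑ x_j ⊗ t_j` lies in `𝔪² (S ⊗ T)` for a basis `x_j` of `V`, then all `t_j` vanish. -/
theorem eq_zero_of_sum_mem {I : Type*} [Fintype I] (b : Module.Basis I k V) (t : I → T)
    (h : ∑ j, SymmetricAlgebra.ι k V (b j) ⊗ₜ[k] t j ∈ (maxIdeal k V ^ 2 • ⊤ :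
      Submodule (SymmetricAlgebra k V) (SymmetricAlgebra k V ⊗[k] T))) (j : I) : t j = 0 := by
  classical
  let τ : SymmetricAlgebra k V ⊗[k] T →ₗ[k] T :=
    (TensorProduct.lid k T).toLinearMap ∘ₗ (linCoeff (b.coord j)).rTensor T
  have h1 : ∀ x ∈ (maxIdeal k V ^ 2 • ⊤ :
      Submodule (SymmetricAlgebra k V) (SymmetricAlgebra k V ⊗[k] T)), τ x = 0 := by
    intro x hx
    induction hx using Submodule.smul_induction_on' with
    | add x _ y _ hx hy => rw [map_add, hx, hy, add_zero]
    | smul r hr x _ =>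
      induction x using TensorProduct.induction_on with
      | zero => simp
      | add x y hx hy => rw [smul_add, map_add, hx trivial, hy trivial, add_zero]
      | tmul s t =>
        rw [TensorProduct.smul_tmul', smul_eq_mul]
        change TensorProduct.lid k T (linCoeff (b.coord j) (r * s) ⊗ₜ t) = 0
        rw [linCoeff_of_mem _ (Ideal.mul_mem_right _ _ hr), TensorProduct.zero_tmul, map_zero]
  have h2 := h1 _ h
  have h3 : ∀ i, τ (SymmetricAlgebra.ι k V (b i) ⊗ₜ[k] t i) = if i = j then t i else 0 := by
    intro i
    change TensorProduct.lid k T (linCoeff (b.coord j) _ ⊗ₜ t i) = _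
    rw [linCoeff_ι, TensorProduct.lid_tmul]
    simp [Finsupp.single_apply]
  rw [map_sum] at h2
  simpa [h3] using h2

theorem lTensor_mem_freeDeg {T' : Type*} [AddCommGroup T'] [Module k T'] (f : T →ₗ[k] T')
    {i n : ℤ} {x : SymmetricAlgebra k V ⊗[k] T} (hx : x ∈ freeDeg k V T i n) :
    f.lTensor (SymmetricAlgebra k V) x ∈ freeDeg k V T' i n := by
  have : freeDeg k V T i n ≤ (freeDeg k V T' i n).comap (f.lTensor _) := by
    refine freeDeg_le fun a s t ha hs => ?_
    rw [Submodule.mem_comap, LinearMap.lTensor_tmul]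
    exact tmul_mem_freeDeg hs _ ha
  exact this hx

theorem congr_mem_freeDeg_iff {T' : Type*} [AddCommGroup T'] [Module k T'] (e : T ≃ₗ[k] T')
    {i n : ℤ} {x : SymmetricAlgebra k V ⊗[k] T} :
    TensorProduct.AlgebraTensorModule.congr (LinearEquiv.refl (SymmetricAlgebra k V) _) e x ∈
      freeDeg k V T' i n ↔ x ∈ freeDeg k V T i n := by
  have h : TensorProduct.AlgebraTensorModule.congr (LinearEquiv.refl (SymmetricAlgebra k V) _) e x
      = e.toLinearMap.lTensor (SymmetricAlgebra k V) x := rfl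
  refine ⟨fun hx => ?_, fun hx => h ▸ lTensor_mem_freeDeg e.toLinearMap hx⟩
  have := lTensor_mem_freeDeg e.symm.toLinearMap (h ▸ hx)
  rwa [← LinearMap.comp_apply, ← LinearMap.lTensor_comp, LinearEquiv.symm_comp,
    LinearMap.lTensor_id, LinearMap.id_apply] at this

end FreeModule

/-! ### The maximal irredundant quotient of `L(P)` -/

section Quotient

variable {k : Type u} {V : Type v} [Field k] [AddCommGroup V] [Module k V]

namespace GradedExtModule

variable (P : GradedExtModule.{u, v, w} k V)

/-- The elements of a graded `E`-module which are killed by all products of `n` elements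
of `V^*`. -/
def annihilated : ℕ → Submodule k P.carrier
  | 0 => ⊥
  | n + 1 => ⨅ e, (annihilated n).comap (P.act e)

theorem mem_annihilated_succ {n : ℕ} {p : P.carrier} :
    p ∈ P.annihilated (n + 1) ↔ ∀ e, P.act e p ∈ P.annihilated n := by
  simp [annihilated]

/-- The elements of degree `i` which are killed by all products of `i` elements of `V^*`. -/
def redundant (i : ℤ) : Submodule k (P.piece i) := (P.annihilated i.toNat).comap (P.piece i).subtype

theorem mem_redundant {i : ℤ} {p : P.piece i} :
    p ∈ P.redundant i ↔ (p : P.carrier) ∈ P.annihilated i.toNat := Iff.rfl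

/-- The degree `i` part of the quotient of `P` by its redundant elements. -/
abbrev irrPiece (i : ℤ) : Type w := P.piece i ⧸ P.redundant i

end GradedExtModule

variable (P : GradedExtModule.{u, v, w} k V)

/-- A product of `i - 1` factors applied after `e` is a product of `i` factors. For `i ≤ 0` the
truncation `Int.toNat` makes the redundant part zero. -/
theorem pieceAct_mem_redundant {i : ℤ} (e : Module.Dual k V) {p : P.piece i}
    (hp : p ∈ P.redundant i) : pieceAct P i e p ∈ P.redundant (i - 1) := by
  rw [P.mem_redundant] at hp ⊢
  by_cases hi : 0 < i
  · rw [show i.toNat = (i - 1).toNat + 1 by omega, P.mem_annihilated_succ] at hp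
    exact hp e
  · rw [show i.toNat = 0 by omega] at hp
    have h0 : p = 0 := Subtype.ext hp
    rw [h0, map_zero]
    exact zero_mem _

/-- The operation of `V^*` on the quotient by the redundant elements. -/
def irrAct (i : ℤ) (e : Module.Dual k V) : P.irrPiece i →ₗ[k] P.irrPiece (i - 1) :=
  Submodule.mapQ _ _ (pieceAct P i e) fun _ hp => pieceAct_mem_redundant P e hp

/-- The projection of `S ⊗ P_i` to the quotient by the redundant elements. -/
def irrProj (i : ℤ) : SymmetricAlgebra k V ⊗[k] P.piece i →ₗ[SymmetricAlgebra k V]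
    SymmetricAlgebra k V ⊗[k] P.irrPiece i :=
  TensorProduct.AlgebraTensorModule.map LinearMap.id (P.redundant i).mkQ

theorem irrProj_tmul (i : ℤ) (s : SymmetricAlgebra k V) (p : P.piece i) :
    irrProj P i (s ⊗ₜ p) = s ⊗ₜ (P.redundant i).mkQ p := rfl

theorem irrProj_surjective (i : ℤ) : Function.Surjective (irrProj P i) :=
  LinearMap.lTensor_surjective _ (P.redundant i).mkQ_surjective

variable [FiniteDimensional k V]

/-- The differential of the maximal irredundant quotient of `L(P)`. -/
def irrDiff (i : ℤ) : SymmetricAlgebra k V ⊗[k] P.irrPiece i →ₗ[SymmetricAlgebra k V]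
    SymmetricAlgebra k V ⊗[k] P.irrPiece (i - 1) :=
  ∑ j, TensorProduct.AlgebraTensorModule.map
    (LinearMap.mulRight (SymmetricAlgebra k V)
      (SymmetricAlgebra.ι k V (Module.finBasis k V j)))
    (irrAct P i ((Module.finBasis k V).coord j))

theorem irrDiff_tmul (i : ℤ) (s : SymmetricAlgebra k V) (p : P.irrPiece i) :
    irrDiff P i (s ⊗ₜ[k] p) = ∑ j, (s * SymmetricAlgebra.ι k V (Module.finBasis k V j)) ⊗ₜ[k]
      irrAct P i ((Module.finBasis k V).coord j) p := by
  simp [irrDiff, LinearMap.sum_apply]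

theorem irrProj_linDiff (i : ℤ) (x : SymmetricAlgebra k V ⊗[k] P.piece i) :
    irrProj P (i - 1) (linDiff P i x) = irrDiff P i (irrProj P i x) := by
  induction x using TensorProduct.induction_on with
  | zero => simp
  | add x y hx hy => simp only [map_add, hx, hy]
  | tmul s p =>
    rw [linDiff_tmul, irrProj_tmul, irrDiff_tmul, map_sum]
    rfl

/-- The quotient of `L(P)` by the redundant elements of `P`. -/
def irrComplex : GradedComplex.{u, v, max u v w} k V where
  X i := SymmetricAlgebra k V ⊗[k] P.irrPiece i
  deg i n := freeDeg k V (P.irrPiece i) i n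
  isInternal i := isInternal_freeDeg i
  smul_mem i n a s x hs hx := by
    have : freeDeg k V (P.irrPiece i) i n ≤ (freeDeg k V (P.irrPiece i) i (n + a)).comap
        (Algebra.lsmul k k (SymmetricAlgebra k V ⊗[k] P.irrPiece i) s) := by
      refine freeDeg_le fun b r t hb hr => ?_
      rw [Submodule.mem_comap, Algebra.lsmul_coe]
      change (s * r) ⊗ₜ[k] t ∈ _
      exact tmul_mem_freeDeg (symPower_mul_mem hs hr) t (by push_cast; omega)
    exact this hx
  d i := irrDiff P i
  d_mem i n x hx := by
    have : freeDeg k V (P.irrPiece i) i n ≤ (freeDeg k V (P.irrPiece (i - 1)) (i - 1) n).comap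
        ((irrDiff P i).restrictScalars k) := by
      refine freeDeg_le fun b r t hb hr => ?_
      rw [Submodule.mem_comap, LinearMap.restrictScalars_apply, irrDiff_tmul]
      exact sum_mem fun j _ => tmul_mem_freeDeg (symPower_mul_mem hr (ι_mem_symPower _)) _
        (by push_cast; omega)
    exact this hx
  d_d i x := by
    obtain ⟨x, rfl⟩ := irrProj_surjective P i x
    rw [← irrProj_linDiff, ← irrProj_linDiff]
    exact (congrArg _ ((linComplex P).d_d i x)).trans (map_zero _)

/-- The projection of `L(P)` to its quotient by the redundant elements of `P`. -/
def irrHom : GradedComplex.Hom (linComplex P) (irrComplex P) where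
  f i := irrProj P i
  deg_mem _ _ _ hx := lTensor_mem_freeDeg _ hx
  comm i x := irrProj_linDiff P i x

variable {P}

theorem linComplex_isStandardLinearFree (hP : ∀ i, i < 0 → Subsingleton (P.piece i)) :
    (linComplex P).IsStandardLinearFree := by
  refine ⟨fun i hi => ?_, fun i => exists_basis_freeDeg i⟩
  have := hP i hi
  exact inferInstanceAs (Subsingleton (SymmetricAlgebra k V ⊗[k] P.piece i))

theorem irrComplex_isStandardLinearFree (hP : ∀ i, i < 0 → Subsingleton (P.piece i)) :
    (irrComplex P).IsStandardLinearFree := by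
  refine ⟨fun i hi => ?_, fun i => exists_basis_freeDeg i⟩
  have := hP i hi
  have : Subsingleton (P.irrPiece i) := (P.redundant i).mkQ_surjective.subsingleton
  exact inferInstanceAs (Subsingleton (SymmetricAlgebra k V ⊗[k] P.irrPiece i))

theorem coord_mem_span (e : Module.Dual k V) :
    e ∈ Submodule.span k (Set.range (Module.finBasis k V).coord) := by
  classical
  have := (Module.finBasis k V).dualBasis.mem_span e
  rwa [Module.Basis.coe_dualBasis] at this

/-- Only the class of `x` modulo `𝔪` matters, say that of `1 ⊗ t`. The linear coefficients of its
differential are the `e_j t`; if these vanish in the quotient, a lift of `t` has only redundant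
multiples and so is redundant, that is, `t = 0`. -/
theorem mem_maxIdeal_smul_of_irrDiff_mem {i : ℤ} (hi : 0 < i)
    (x : SymmetricAlgebra k V ⊗[k] P.irrPiece i)
    (hx : irrDiff P i x ∈ (maxIdeal k V ^ 2 • ⊤ : Submodule (SymmetricAlgebra k V)
      (SymmetricAlgebra k V ⊗[k] P.irrPiece (i - 1)))) :
    x ∈ (maxIdeal k V • ⊤ : Submodule (SymmetricAlgebra k V)
      (SymmetricAlgebra k V ⊗[k] P.irrPiece i)) := by
  obtain ⟨t, ht⟩ := exists_sub_one_tmul_mem (k := k) (V := V) (T := P.irrPiece i) x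
  have hd : ∀ y ∈ (maxIdeal k V • ⊤ : Submodule (SymmetricAlgebra k V)
      (SymmetricAlgebra k V ⊗[k] P.irrPiece i)), irrDiff P i y ∈ (maxIdeal k V ^ 2 • ⊤ :
      Submodule (SymmetricAlgebra k V) (SymmetricAlgebra k V ⊗[k] P.irrPiece (i - 1))) := by
    intro y hy
    induction hy using Submodule.smul_induction_on' with
    | add x _ y _ hx hy => rw [map_add]; exact add_mem hx hy
    | smul r hr x _ =>
      rw [map_smul, pow_two, ← smul_eq_mul, Submodule.smul_assoc]
      refine Submodule.smul_mem_smul hr ?_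
      induction x using TensorProduct.induction_on with
      | zero => simp
      | add x y hx hy => rw [map_add]; exact add_mem (hx trivial) (hy trivial)
      | tmul s p =>
        rw [irrDiff_tmul]
        exact sum_mem fun j _ => tmul_mem_ideal_smul
          (Ideal.mul_mem_left _ _ (ι_mem_maxIdeal _)) _
  have h1 : irrDiff P i (1 ⊗ₜ t) ∈ (maxIdeal k V ^ 2 • ⊤ : Submodule (SymmetricAlgebra k V)
      (SymmetricAlgebra k V ⊗[k] P.irrPiece (i - 1))) := by
    have := sub_mem hx (hd _ ht)
    rwa [map_sub, sub_sub_cancel] at this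
  rw [irrDiff_tmul] at h1
  simp only [one_mul] at h1
  have h2 := eq_zero_of_sum_mem (Module.finBasis k V) _ h1
  obtain ⟨p, rfl⟩ := (P.redundant i).mkQ_surjective t
  have h3 : p ∈ P.redundant i := by
    rw [P.mem_redundant, show i.toNat = (i - 1).toNat + 1 by omega, P.mem_annihilated_succ]
    intro e
    have he := coord_mem_span e
    induction he using Submodule.span_induction with
    | zero => rw [P.act_apply, map_zero, zero_smul]; exact zero_mem _
    | add e f _ _ he hf => rw [P.act_add]; exact add_mem he hf
    | smul c e _ he => rw [P.act_smul]; exact Submodule.smul_mem _ _ he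
    | mem e he =>
      obtain ⟨j, rfl⟩ := he
      have h4 : (Submodule.Quotient.mk (pieceAct P i ((Module.finBasis k V).coord j) p) :
        P.irrPiece (i - 1)) = 0 := h2 j
      have h5 : pieceAct P i ((Module.finBasis k V).coord j) p ∈ P.redundant (i - 1) :=
        (Submodule.Quotient.mk_eq_zero _).1 h4
      exact h5
  rw [Submodule.mkQ_apply, (Submodule.Quotient.mk_eq_zero _).2 h3, TensorProduct.tmul_zero,
    sub_zero] at ht
  exact ht

theorem irrComplex_isIrredundant : (irrComplex P).IsIrredundant :=
  fun _ hi x hx => mem_maxIdeal_smul_of_irrDiff_mem hi x hx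

/-- Redundant elements map to zero in every irredundant standard linear free complex. -/
theorem apply_one_tmul_eq_zero (G : GradedComplex.{u, v, max u v w} k V)
    (ρ : GradedComplex.Hom (linComplex P) G) (hG : G.IsStandardLinearFree) (hG' : G.IsIrredundant)
    {i : ℤ} (p : P.piece i) (hp : p ∈ P.redundant i) :
    ρ.f i ((1 ⊗ₜ p : SymmetricAlgebra k V ⊗[k] P.piece i)) = 0 := by
  obtain ⟨n, hn⟩ : ∃ n, n = i.toNat := ⟨_, rfl⟩
  induction n generalizing i with
  | zero =>
    rw [P.mem_redundant, ← hn] at hp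
    have h0 : (1 : SymmetricAlgebra k V) ⊗ₜ[k] p = 0 := by
      rw [show p = 0 from Subtype.ext hp, TensorProduct.tmul_zero]
    exact (congrArg (ρ.f i) h0).trans (map_zero _)
  | succ n ih =>
    have hdeg : (1 ⊗ₜ p : SymmetricAlgebra k V ⊗[k] P.piece i) ∈ freeDeg k V (P.piece i) i i := by
      refine tmul_mem_freeDeg (a := 0) ?_ _ (by simp)
      rw [symPower, pow_zero]
      exact Submodule.one_le.1 le_rfl
    -- Irredundancy places the image of `1 ⊗ p` in `𝔪 G_i` once its differential is zero, while the
    -- image has the degree `i` of a generator.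
    refine GradedComplex.eq_zero_of_mem_maxIdeal_smul hG (ρ.deg_mem i i _ hdeg)
      (hG' i (by omega) _ ?_)
    let r : SymmetricAlgebra k V ⊗[k] P.piece (i - 1) →ₗ[SymmetricAlgebra k V] G.X (i - 1) :=
      ρ.f (i - 1)
    have h1 : r (linDiff P i (1 ⊗ₜ p)) = 0 := by
      rw [linDiff_tmul, map_sum]
      refine Finset.sum_eq_zero fun j _ => ?_
      have h2 : r (1 ⊗ₜ pieceAct P i ((Module.finBasis k V).coord j) p) = 0 :=
        ih _ (pieceAct_mem_redundant P _ hp) (by omega)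
      rw [one_mul, ← mul_one (SymmetricAlgebra.ι k V _), ← smul_eq_mul,
        ← TensorProduct.smul_tmul', map_smul, h2, smul_zero]
    have h3 : G.d i (ρ.f i ((1 ⊗ₜ p : SymmetricAlgebra k V ⊗[k] P.piece i))) = 0 :=
      (ρ.comm i _).symm.trans h1
    exact h3 ▸ zero_mem _

/-- By right exactness of the tensor product, the kernel of the projection is generated by `1 ⊗ p`
with `p` redundant. -/
theorem ker_irrProj_le (G : GradedComplex.{u, v, max u v w} k V)
    (ρ : GradedComplex.Hom (linComplex P) G) (hG : G.IsStandardLinearFree) (hG' : G.IsIrredundant)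
    (i : ℤ) (x : SymmetricAlgebra k V ⊗[k] P.piece i) (hx : irrProj P i x = 0) :
    ρ.f i x = 0 := by
  have h1 : Function.Exact ((P.redundant i).subtype.lTensor (SymmetricAlgebra k V))
      ((P.redundant i).mkQ.lTensor (SymmetricAlgebra k V)) :=
    lTensor_exact _ (LinearMap.exact_subtype_mkQ _) (Submodule.mkQ_surjective _)
  obtain ⟨y, rfl⟩ := (h1 x).1 hx
  induction y using TensorProduct.induction_on with
  | zero => rw [map_zero]; exact map_zero _
  | add y z hy hz =>
    rw [map_add]
    refine (map_add (ρ.f i) _ _).trans ?_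
    rw [hy ?_, hz ?_, add_zero]
    · exact (h1 _).2 ⟨_, rfl⟩
    · exact (h1 _).2 ⟨_, rfl⟩
  | tmul s p =>
    let r : SymmetricAlgebra k V ⊗[k] P.piece i →ₗ[SymmetricAlgebra k V] G.X i := ρ.f i
    have h2 : r (1 ⊗ₜ (p : P.piece i)) = 0 :=
      apply_one_tmul_eq_zero G ρ hG hG' (p : P.piece i) p.2
    change r (s ⊗ₜ (p : P.piece i)) = 0
    rw [← mul_one s, ← smul_eq_mul, ← TensorProduct.smul_tmul', map_smul, h2, smul_zero]

theorem irrHom_isMaximalIrredundantQuotient (hP : ∀ i, i < 0 → Subsingleton (P.piece i)) :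
    GradedComplex.IsMaximalIrredundantQuotient (irrHom P) where
  surjective := irrProj_surjective P
  linearFree := irrComplex_isStandardLinearFree hP
  irredundant := irrComplex_isIrredundant
  factors G ρ _ hG hG' := by
    refine GradedComplex.exists_factor (irrHom P) ρ (ker_irrProj_le G ρ hG hG') ?_
      (irrProj_surjective P)
    intro i n x hx
    have : freeDeg k V (P.irrPiece i) i n ≤
        (freeDeg k V (P.piece i) i n).map ((irrProj P i).restrictScalars k) := by
      refine freeDeg_le fun a s t ha hs => ?_
      obtain ⟨p, rfl⟩ := (P.redundant i).mkQ_surjective t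
      exact ⟨s ⊗ₜ p, tmul_mem_freeDeg hs p ha, rfl⟩
    exact this hx

/-- The terms of a maximal irredundant quotient of `L(P)` in positions without redundant elements
agree with those of `L(P)`. -/
theorem bijective_of_redundant_eq_bot (hP : ∀ i, i < 0 → Subsingleton (P.piece i)) {i : ℤ}
    (hi : P.redundant i = ⊥) {F' : GradedComplex.{u, v, max u v w} k V}
    {π : GradedComplex.Hom (linComplex P) F'} (hπ : GradedComplex.IsMaximalIrredundantQuotient π) :
    Function.Bijective (π.f i) := by
  refine ⟨(injective_iff_map_eq_zero _).2 fun x hx => ?_, hπ.surjective i⟩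
  have h1 : irrProj P i x = 0 :=
    hπ.apply_eq_zero (irrHom_isMaximalIrredundantQuotient hP) hx
  have h2 : Function.Injective ((P.redundant i).mkQ.lTensor (SymmetricAlgebra k V)) := by
    refine Module.Flat.lTensor_preserves_injective_linearMap _ ?_
    rw [← LinearMap.ker_eq_bot, Submodule.ker_mkQ, hi]
  exact h2 (h1.trans (map_zero _).symm)

/-- The description of such a term as a graded free module. -/
theorem exists_equiv_of_bijective {T : Type*} [AddCommGroup T] [Module k T] {i : ℤ}
    (e : P.piece i ≃ₗ[k] T) {F' : GradedComplex.{u, v, max u v w} k V}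
    {π : GradedComplex.Hom (linComplex P) F'} (hπ : Function.Bijective (π.f i)) :
    ∃ φ : F'.X i ≃ₗ[SymmetricAlgebra k V] SymmetricAlgebra k V ⊗[k] T,
      ∀ (n : ℤ) (x : F'.X i), x ∈ F'.deg i n ↔ φ x ∈ freeDeg k V T i n := by
  let ε : (SymmetricAlgebra k V ⊗[k] P.piece i) ≃ₗ[SymmetricAlgebra k V] F'.X i :=
    LinearEquiv.ofBijective (π.f i) hπ
  refine ⟨ε.symm ≪≫ₗ TensorProduct.AlgebraTensorModule.congr
    (LinearEquiv.refl (SymmetricAlgebra k V) _) e, fun n x => ?_⟩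
  obtain ⟨y, rfl⟩ := ε.surjective x
  rw [LinearEquiv.trans_apply, LinearEquiv.symm_apply_apply]
  refine Iff.trans ?_ (congr_mem_freeDeg_iff e).symm
  exact ⟨fun h => mem_of_apply_mem ((linComplex P).isInternal i) (F'.isInternal i)
    ((π.f i).restrictScalars k) hπ.1 (fun n x => π.deg_mem i n x) h, fun h => π.deg_mem i n y h⟩

end Quotient

/-! ### Graded duals as spaces of functionals -/

namespace GradedExtModule

variable {k : Type u} {V : Type v} [Field k] [AddCommGroup V] [Module k V]
  (P : GradedExtModule.{u, v, w} k V)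

theorem isCompl_piece (i : ℤ) : IsCompl (P.piece i) (⨆ (j) (_ : j ≠ i), P.piece j) := by
  refine ⟨P.isInternal.submodule_iSupIndep i, codisjoint_iff.2 ?_⟩
  rw [← iSup_split_single, P.isInternal.submodule_iSup_eq_top]

/-- The elements of the graded dual as functionals. -/
def dualEval : P.dual.carrier →ₗ[k] Module.Dual k P.carrier := P.dualIncl

theorem dualEval_injective : Function.Injective P.dualEval := P.dualIncl_injective

theorem dualEval_act (e : Module.Dual k V) (f : P.dual.carrier) (p : P.carrier) :
    P.dualEval (P.dual.act e f) p = P.dualEval f (P.act e p) :=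
  congrArg (fun g : P.DualCarrier => P.dualIncl g p) (P.dual_ι_smul e f)

theorem dualEval_eq_zero {i j : ℤ} {f : P.dual.carrier} (hf : f ∈ P.dual.piece i) (hj : j ≠ -i)
    {p : P.carrier} (hp : p ∈ P.piece j) : P.dualEval f p = 0 :=
  hf j hj p hp

theorem eq_zero_of_dualEval_eq_zero {i : ℤ} {f : P.dual.carrier} (hf : f ∈ P.dual.piece i)
    (h : ∀ p ∈ P.piece (-i), P.dualEval f p = 0) : f = 0 := by
  refine P.dualEval_injective (Eq.trans ?_ (map_zero P.dualEval).symm)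
  have : (⊤ : Submodule k P.carrier) ≤ LinearMap.ker (P.dualEval f) := by
    rw [← (P.isCompl_piece (-i)).sup_eq_top]
    exact sup_le h (iSup₂_le fun j hj p hp => P.dualEval_eq_zero hf hj hp)
  exact LinearMap.ext fun p => this trivial

/-- The degree `i` piece of the graded dual is the dual of the piece of degree `-i`. -/
def dualPieceEquiv (i : ℤ) : P.dual.piece i ≃ₗ[k] Module.Dual k (P.piece (-i)) :=
  LinearEquiv.ofBijective
    ((P.piece (-i)).subtype.dualMap ∘ₗ P.dualEval ∘ₗ (P.dual.piece i).subtype) <| by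
    constructor
    · rw [injective_iff_map_eq_zero]
      intro f hf
      exact Subtype.ext (P.eq_zero_of_dualEval_eq_zero f.2 fun p hp => LinearMap.congr_fun hf ⟨p, hp⟩)
    · intro g
      -- A functional on one piece is extended by zero on the other pieces.
      let f : Module.Dual k P.carrier := g ∘ₗ (P.piece (-i)).projectionOnto _ (P.isCompl_piece (-i))
      have hf : f ∈ P.dualPiece i := fun j hj p hp => by
        have : p ∈ ⨆ (j) (_ : j ≠ -i), P.piece j :=
          Submodule.mem_iSup_of_mem j (Submodule.mem_iSup_of_mem hj hp)
        change g _ = 0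
        rw [(Submodule.projectionOnto_apply_eq_zero_iff _).2 this, map_zero]
      exact ⟨⟨⟨f, Submodule.mem_iSup_of_mem i hf⟩, hf⟩, LinearMap.ext fun p =>
        congrArg g (Submodule.projectionOnto_apply_left (P.isCompl_piece (-i)) p)⟩

/-- Elements killed by all products of `n` elements of `V^*` vanish on the multiples of such
products. -/
theorem dualEval_prod_eq_zero {n : ℕ} {f : P.dual.carrier} (hf : f ∈ P.dual.annihilated n)
    (e : Fin n → Module.Dual k V) (p : P.carrier) :
    P.dualEval f ((List.ofFn fun t => P.act (e t)).prod p) = 0 := by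
  induction n generalizing f with
  | zero =>
    have : f = 0 := hf
    rw [this, map_zero, LinearMap.zero_apply]
  | succ n ih =>
    rw [mem_annihilated_succ] at hf
    have h1 := ih (hf (e 0)) (fun t => e t.succ)
    rw [dualEval_act] at h1
    rw [List.ofFn_succ, List.prod_cons, Module.End.mul_apply]
    exact h1

end GradedExtModule

/-! ### The graded pieces of `Q` and `Q^*` -/

section Pieces

variable {k : Type u} [Field k] {U V W : Type*} [AddCommGroup U] [Module k U]
  [AddCommGroup V] [Module k V] [AddCommGroup W] [Module k W]

instance {M : Type*} [AddCommGroup M] [Module k M] [FiniteDimensional k M] (n : ℕ) :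
    FiniteDimensional k (symPower k M n) := by
  refine Module.Finite.iff_fg.2 (Submodule.FG.pow ?_ n)
  rw [LinearMap.range_eq_map]
  exact Submodule.FG.map _ Module.Finite.fg_top

theorem finrank_symPower_zero {M : Type*} [AddCommGroup M] [Module k M] :
    Module.finrank k (symPower k M 0) = 1 := by
  rw [symPower, pow_zero, Submodule.one_eq_range]
  exact (LinearMap.finrank_range_of_inj (FaithfulSMul.algebraMap_injective k (SymmetricAlgebra k M))).trans
    (Module.finrank_self k)

variable (k U W) in
/-- The piece `⋀^a W^* ⊗ Sym_b(U^*)` as a tensor product. -/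
def bigPieceEquiv (a b : ℕ) :
    ↥(⋀[k]^a (Module.Dual k W)) ⊗[k] symPower k (Module.Dual k U) b ≃ₗ[k] bigPiece k W U a b :=
  (LinearEquiv.ofInjective (TensorProduct.mapIncl (⋀[k]^a (Module.Dual k W))
    (symPower k (Module.Dual k U) b)) (TensorProduct.map_injective_of_flat_flat _ _ Subtype.val_injective
      Subtype.val_injective)).trans
    (LinearEquiv.ofEq _ _ (by rw [bigPiece, TensorProduct.range_mapIncl, Submodule.map₂_eq_span_image2]))

variable [FiniteDimensional k U] [FiniteDimensional k W] (μ : W ⊗[k] U →ₗ[k] V)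

/-- The inclusion of `Q` in `⋀ W^* ⊗ Sym(U^*)`. -/
def gradedQIncl : (gradedQ μ).carrier →ₗ[k] bigAlg k W U := carrierQ.incl μ

theorem gradedQIncl_injective : Function.Injective (gradedQIncl μ) := Subtype.val_injective

theorem mem_gradedQ_piece (l : ℕ) (q : (gradedQ μ).carrier) :
    q ∈ (gradedQ μ).piece (-l) ↔ gradedQIncl μ q ∈ bigPiece k W U (l + 1) l := by
  change gradedQIncl μ q ∈ (if -(l : ℤ) ≤ 0 then bigPiece k W U ((-(-(l : ℤ))).toNat + 1)
    (-(-(l : ℤ))).toNat else ⊥) ↔ _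
  rw [if_pos (by omega), neg_neg, Int.toNat_natCast]

theorem exists_gradedQIncl_eq {l : ℕ} {x : bigAlg k W U} (hx : x ∈ bigPiece k W U (l + 1) l) :
    ∃ q : (gradedQ μ).carrier, gradedQIncl μ q = x :=
  ⟨(⟨x, Submodule.mem_iSup_of_mem l hx⟩ : modQ k W U), rfl⟩

theorem gradedQIncl_act (e : Module.Dual k V) (q : (gradedQ μ).carrier) :
    gradedQIncl μ ((gradedQ μ).act e q) = inclOne k W U (dualPairing μ e) * gradedQIncl μ q := by
  change (extMap μ (ExteriorAlgebra.ι k e) : bigAlg k W U) * carrierQ.incl μ q = _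
  rw [extMap, ExteriorAlgebra.lift_ι_apply]
  rfl

theorem subsingleton_gradedQ_piece {i : ℤ} (hi : 0 < i) : Subsingleton ((gradedQ μ).piece i) := by
  have : (gradedQ μ).piece i = ⊥ := by
    change (if i ≤ 0 then _ else ⊥ : Submodule k (bigAlg k W U)).comap (gradedQIncl μ) = ⊥
    rw [if_neg (by omega)]
    exact LinearMap.ker_eq_bot.2 (gradedQIncl_injective μ)
  rw [this]
  infer_instance

theorem map_gradedQ_piece (l : ℕ) :
    ((gradedQ μ).piece (-l)).map (gradedQIncl μ) = bigPiece k W U (l + 1) l := by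
  refine le_antisymm (Submodule.map_le_iff_le_comap.2 fun q hq => (mem_gradedQ_piece μ l q).1 hq)
    fun x hx => ?_
  obtain ⟨q, rfl⟩ := exists_gradedQIncl_eq μ hx
  exact Submodule.mem_map_of_mem ((mem_gradedQ_piece μ l q).2 hx)

/-- The piece of `Q` of degree `-l`. -/
def gradedQPieceEquiv (l : ℕ) : (gradedQ μ).piece (-l) ≃ₗ[k] bigPiece k W U (l + 1) l :=
  (Submodule.equivMapOfInjective (gradedQIncl μ) (gradedQIncl_injective μ) _).trans
    (LinearEquiv.ofEq _ _ (map_gradedQ_piece μ l))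

/-- The piece of `Q^*` of degree `l`. -/
def dualQPieceEquiv (l : ℕ) : (gradedQ μ).dual.piece l ≃ₗ[k]
    Module.Dual k (↥(⋀[k]^(l + 1) (Module.Dual k W)) ⊗[k] symPower k (Module.Dual k U) l) :=
  ((gradedQ μ).dualPieceEquiv l).trans
    ((bigPieceEquiv k U W (l + 1) l).trans (gradedQPieceEquiv μ l).symm).dualMap

instance (l : ℕ) : FiniteDimensional k ((gradedQ μ).dual.piece l) :=
  (dualQPieceEquiv μ l).symm.finiteDimensional

theorem finrank_dualQ_piece (l : ℕ) : Module.finrank k ((gradedQ μ).dual.piece l) =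
    (Module.finrank k W).choose (l + 1) * Module.finrank k (symPower k (Module.Dual k U) l) := by
  refine (dualQPieceEquiv μ l).finrank_eq.trans ((Subspace.dual_finrank_eq (K := k)
    (V := ↥(⋀[k]^(l + 1) (Module.Dual k W)) ⊗[k] symPower k (Module.Dual k U) l)).trans ?_)
  rw [Module.finrank_tensorProduct, exteriorPower.finrank_eq, Subspace.dual_finrank_eq]

theorem subsingleton_dualQ_piece_of_neg {i : ℤ} (hi : i < 0) :
    Subsingleton ((gradedQ μ).dual.piece i) := by
  have := subsingleton_gradedQ_piece μ (i := -i) (by omega)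
  exact ((gradedQ μ).dualPieceEquiv i).injective.subsingleton

theorem subsingleton_dualQ_piece {i : ℤ} (hi : (Module.finrank k W : ℤ) ≤ i) :
    Subsingleton ((gradedQ μ).dual.piece i) := by
  obtain ⟨l, rfl⟩ : ∃ l : ℕ, i = l := ⟨i.toNat, by omega⟩
  refine Module.finrank_zero_iff.1 ((finrank_dualQ_piece μ l).trans ?_)
  -- The factor `⋀^{l+1} W^*` vanishes for `l ≥ dim W`.
  rw [Nat.choose_eq_zero_of_lt (by omega), zero_mul]

end Pieces

/-! ### Products on the top piece of `Q` are minors -/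

section TopForm

variable {k : Type u} [Field k] {U V W : Type*} [AddCommGroup U] [Module k U]
  [AddCommGroup V] [Module k V] [AddCommGroup W] [Module k W]

theorem exteriorPower_card_le_span {n : ℕ} {M : Type*} [AddCommGroup M] [Module k M]
    (b : Module.Basis (Fin n) k M) :
    ⋀[k]^n M ≤ Submodule.span k {ExteriorAlgebra.ιMulti k n b} := by
  rw [← exteriorPower.ιMulti_span_fixedDegree_of_span_eq_top k n M b.span_eq, Submodule.span_le]
  rintro _ ⟨a, ha, rfl⟩
  obtain ⟨J, rfl⟩ := Set.range_subset_range_iff_exists_comp.1 ha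
  by_cases hJ : Function.Injective J
  · have := (ExteriorAlgebra.ιMulti k n).map_perm b
      (Equiv.ofBijective J (Finite.injective_iff_bijective.1 hJ))
    change ExteriorAlgebra.ιMulti k n (b ∘ J) = _ at this
    rw [this]
    exact Submodule.smul_of_tower_mem _ _ (Submodule.mem_span_singleton_self _)
  · rw [(ExteriorAlgebra.ιMulti k n).map_eq_zero_of_not_injective _
      fun h => hJ (Function.Injective.of_comp h)]
    exact zero_mem _

theorem ιMulti_snoc {n : ℕ} {M : Type*} [AddCommGroup M] [Module k M] (a : Fin n → M) (m : M) :
    ExteriorAlgebra.ιMulti k (n + 1) (Fin.snoc a m : Fin (n + 1) → M) =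
      (List.ofFn fun t => ExteriorAlgebra.ι k (a t)).prod * ExteriorAlgebra.ι k m := by
  rw [ExteriorAlgebra.ιMulti_apply, List.ofFn_succ', List.concat_eq_append, List.prod_append]
  simp

/-- The expansion of a product of generic linear combinations in `⋀ ⊗ R` as a determinant. -/
theorem list_prod_mul_ι {n : ℕ} {M R : Type*} [AddCommGroup M] [Module k M] [CommRing R]
    [Algebra k R] (y : Fin (n + 1) → M) (s : Fin n → Fin (n + 1) → R) :
    (List.ofFn fun t => ∑ j, ExteriorAlgebra.ι k (y j) ⊗ₜ[k] s t j).prod *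
        ExteriorAlgebra.ι k (y (Fin.last n)) ⊗ₜ[k] (1 : R) =
      ExteriorAlgebra.ιMulti k (n + 1) y ⊗ₜ[k]
        (Matrix.of fun t j : Fin n => s t j.castSucc).det := by
  have hterm : ∀ J : Fin n → Fin (n + 1),
      (List.ofFn fun t => ExteriorAlgebra.ι k (y (J t)) ⊗ₜ[k] s t (J t)).prod *
        ExteriorAlgebra.ι k (y (Fin.last n)) ⊗ₜ[k] (1 : R) =
      ExteriorAlgebra.ιMulti k (n + 1) (y ∘ (Fin.snoc J (Fin.last n) : Fin (n + 1) → Fin (n + 1)))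
        ⊗ₜ[k] ∏ t, s t (J t) := fun J => by
    have h : ∀ (m : ℕ) (a : Fin m → ExteriorAlgebra k M) (r : Fin m → R),
        (List.ofFn fun t => a t ⊗ₜ[k] r t).prod = (List.ofFn a).prod ⊗ₜ[k] ∏ t, r t := by
      intro m a r
      induction m with
      | zero => simp [Algebra.TensorProduct.one_def]
      | succ m ih =>
        rw [List.ofFn_succ, List.prod_cons, ih, Algebra.TensorProduct.tmul_mul_tmul,
          List.ofFn_succ, List.prod_cons, Fin.prod_univ_succ]
    rw [h, Algebra.TensorProduct.tmul_mul_tmul, mul_one, Fin.comp_snoc, ιMulti_snoc]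
    rfl
  rw [list_prod_sum (k := k), Finset.sum_mul, Finset.sum_congr rfl fun J _ => hterm J,
    ← Matrix.det_transpose, Matrix.det_apply, TensorProduct.tmul_sum]
  symm
  -- Since `y (Fin.last n)` is already a factor, a choice `J` contributes only if it is injective
  -- and avoids `Fin.last n`, that is, if it is a permutation of the remaining `n` indices.
  refine Fintype.sum_of_injective
    (fun σ : Equiv.Perm (Fin n) => fun t => (σ t).castSucc) (fun σ τ h => ?_) _ _ (fun J hJ => ?_)
    (fun σ => ?_)
  · exact Equiv.ext fun t => Fin.castSucc_injective n (congrFun h t)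
  · rw [(ExteriorAlgebra.ιMulti k (n + 1)).map_eq_zero_of_not_injective, TensorProduct.zero_tmul]
    intro h
    have h1 : Function.Injective (Fin.snoc J (Fin.last n) : Fin (n + 1) → Fin (n + 1)) :=
      Function.Injective.of_comp h
    have h2 : ∀ t, J t ≠ Fin.last n := fun t ht => by
      have := @h1 t.castSucc (Fin.last n) (by simpa using ht)
      exact (Fin.castSucc_lt_last t).ne this
    have h3 : Function.Injective fun t => (J t).castPred (h2 t) := fun a b hab => by
      have h4 : J a = J b := Fin.castPred_inj.1 hab
      exact Fin.castSucc_injective n (@h1 a.castSucc b.castSucc (by simpa using h4))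
    exact hJ ⟨Equiv.ofBijective _ (Finite.injective_iff_bijective.1 h3), funext fun t => by simp⟩
  · have h1 : (Fin.snoc (fun t => (σ t).castSucc) (Fin.last n) : Fin (n + 1) → Fin (n + 1)) =
        (Equiv.Perm.viaFintypeEmbedding σ Fin.castSuccEmb : Fin (n + 1) → Fin (n + 1)) := by
      funext t
      refine Fin.lastCases ?_ (fun i => ?_) t
      · rw [Fin.snoc_last, Equiv.Perm.viaFintypeEmbedding_apply_notMem_range]
        rintro ⟨i, hi⟩
        exact (Fin.castSucc_lt_last i).ne hi
      · rw [Fin.snoc_castSucc]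
        exact (Equiv.Perm.viaFintypeEmbedding_apply_image σ Fin.castSuccEmb i).symm
    have h2 := (ExteriorAlgebra.ιMulti k (n + 1)).map_perm y
      (Equiv.Perm.viaFintypeEmbedding σ Fin.castSuccEmb)
    rw [Equiv.Perm.viaFintypeEmbedding_sign] at h2
    rw [h1]
    refine Eq.trans ?_ (congrArg (· ⊗ₜ[k] _) h2).symm
    rcases Int.units_eq_one_or (Equiv.Perm.sign σ) with hσ | hσ <;>
      simp [hσ, TensorProduct.neg_tmul, TensorProduct.tmul_neg]

variable [FiniteDimensional k U] [FiniteDimensional k W] (μ : W ⊗[k] U →ₗ[k] V)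

theorem dualPairing_eq_sum {l : Type*} [Fintype l] (bW : Module.Basis l k W)
    (e : Module.Dual k V) : dualPairing μ e =
      ∑ j, bW.coord j ⊗ₜ[k] (e ∘ₗ μ ∘ₗ TensorProduct.mk k W U (bW j)) := by
  refine (TensorProduct.dualDistribEquiv k W U).injective ?_
  refine (LinearEquiv.apply_symm_apply _ _).trans (TensorProduct.ext' fun x b => ?_)
  change e (μ (x ⊗ₜ b)) = TensorProduct.dualDistrib k W U _ _
  rw [map_sum, LinearMap.sum_apply]
  simp only [TensorProduct.dualDistrib_apply, LinearMap.comp_apply, TensorProduct.mk_apply]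
  conv_lhs => rw [← bW.sum_repr x, TensorProduct.sum_tmul, map_sum, map_sum]
  refine Finset.sum_congr rfl fun j _ => ?_
  rw [← TensorProduct.smul_tmul', map_smul, map_smul]
  rfl

theorem gradedQIncl_prod {n : ℕ} (e : Fin n → Module.Dual k V) (q : (gradedQ μ).carrier) :
    gradedQIncl μ ((List.ofFn fun t => (gradedQ μ).act (e t)).prod q) =
      (List.ofFn fun t => inclOne k W U (dualPairing μ (e t))).prod * gradedQIncl μ q := by
  induction n with
  | zero => simp
  | succ n ih =>
    rw [List.ofFn_succ, List.prod_cons, Module.End.mul_apply, gradedQIncl_act, ih, List.ofFn_succ,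
      List.prod_cons, mul_assoc]

/-- The witness is the last dual basis vector, an element of `W^* = Q_0`. A coordinate form of `V`
acts through a row of the linear matrix, by `dualPairing_eq_sum`, so `list_prod_mul_ι` identifies
the product with a minor omitting the last column. -/
theorem exists_gradedQIncl_prod_eq {n : ℕ} {m : Type*} (bW : Module.Basis (Fin (n + 1)) k W)
    (bV : Module.Basis m k V) (r : Fin n → m) : ∃ q : (gradedQ μ).carrier,
      gradedQIncl μ ((List.ofFn fun t => (gradedQ μ).act (bV.coord (r t))).prod q) =
        ExteriorAlgebra.ιMulti k (n + 1) bW.coord ⊗ₜ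
          ((linearMatrix bW bV μ).submatrix r Fin.castSucc).det := by
  have h0 : ExteriorAlgebra.ι k (bW.coord (Fin.last n)) ⊗ₜ
      (1 : SymmetricAlgebra k (Module.Dual k U)) ∈ bigPiece k W U (0 + 1) 0 := by
    refine Submodule.apply_mem_map₂ (TensorProduct.mk k _ _) ?_ ?_
    · rw [zero_add, ExteriorAlgebra.exteriorPower, pow_one]
      exact ⟨_, rfl⟩
    · rw [symPower, pow_zero]
      exact Submodule.one_le.1 le_rfl
  obtain ⟨q, hq⟩ := exists_gradedQIncl_eq μ h0
  refine ⟨q, ?_⟩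
  rw [gradedQIncl_prod, hq]
  simp only [dualPairing_eq_sum μ bW, map_sum, inclOne, TensorProduct.map_tmul]
  exact list_prod_mul_ι _ _

/-- A redundant functional vanishes on every product of `n` elements of `V^*` with an element of
`Q`, in particular on the volume form tensor each minor in the first `n` columns. These minors span
`Sym_n(U^*)` and `⋀^{n+1} W^*` is a line, so the functional is zero. -/
theorem redundant_dualQ_eq_bot [FiniteDimensional k V] (hμ : IsGeometricallyOneGeneric μ) {n : ℕ}
    (hn : Module.finrank k W = n + 1) : (gradedQ μ).dual.redundant n = ⊥ := by
  let bW : Module.Basis (Fin (n + 1)) k W := Module.finBasisOfFinrankEq k W hn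
  let bV := Module.finBasis k V
  rw [eq_bot_iff]
  intro f hf
  rw [GradedExtModule.mem_redundant, Int.toNat_natCast] at hf
  refine (Submodule.mem_bot k).2 (Subtype.ext ?_)
  refine (gradedQ μ).eq_zero_of_dualEval_eq_zero f.2 fun p hp => ?_
  -- The kernel of `f`, viewed in `⋀ W^* ⊗ Sym(U^*)`; the aim is that it contains the whole top
  -- piece.
  let K : Submodule k (bigAlg k W U) :=
    (LinearMap.ker ((gradedQ μ).dualEval f)).map (gradedQIncl μ)
  have hK : bigPiece k W U (n + 1) n ≤ K := by
    refine Submodule.map₂_le.2 fun x hx s hs => ?_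
    obtain ⟨c, rfl⟩ := Submodule.mem_span_singleton.1 (exteriorPower_card_le_span bW.dualBasis hx)
    have h1 : symPower k (Module.Dual k U) n ≤ K.comap (TensorProduct.mk k _ _
        (ExteriorAlgebra.ιMulti k (n + 1) bW.dualBasis)) := by
      refine (symPower_le_span_minors hμ bW bV Fin.castSuccEmb).trans
        (Submodule.span_le.2 ?_)
      rintro _ ⟨r, rfl⟩
      obtain ⟨q, hq⟩ := exists_gradedQIncl_prod_eq μ bW bV r
      refine ⟨_, (gradedQ μ).dualEval_prod_eq_zero hf (fun t => bV.coord (r t)) q, ?_⟩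
      rw [hq, TensorProduct.mk_apply, bW.coe_dualBasis]
      rfl
    rw [map_smul]
    exact K.smul_mem c (h1 hs)
  obtain ⟨q, hq, hqp⟩ := hK ((mem_gradedQ_piece μ n p).1 hp)
  rw [← gradedQIncl_injective μ hqp]
  exact hq

/-- In degree `0` the only product is the empty one, which kills nothing but `0`. -/
theorem redundant_zero (P : GradedExtModule k V) : P.redundant 0 = ⊥ := by
  rw [eq_bot_iff]
  intro p hp
  exact (Submodule.mem_bot k).2 (Subtype.ext hp)

end TopForm

/-! ### Identification of the first and last terms by dimension -/

section Terms

variable {k : Type*} [Field k] {U V W : Type*} [AddCommGroup U] [Module k U]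
  [AddCommGroup V] [Module k V] [AddCommGroup W] [Module k W]
  [FiniteDimensional k U] [FiniteDimensional k W] (μ : W ⊗[k] U →ₗ[k] V)

/-- The piece of `Q^*` of degree `n`, up to isomorphism. -/
theorem nonempty_dualQPieceEquiv (n : ℕ) :
    Nonempty ((gradedQ μ).dual.piece n ≃ₗ[k] ⋀[k]^(n + 1) W ⊗[k] dividedPower k U n) := by
  refine FiniteDimensional.nonempty_linearEquiv_of_finrank_eq ?_
  rw [finrank_dualQ_piece, Module.finrank_tensorProduct, exteriorPower.finrank_eq,
    Subspace.dual_finrank_eq]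

/-- The piece of `Q^*` of degree `0`, up to isomorphism. -/
theorem nonempty_dualQPieceEquiv_zero : Nonempty ((gradedQ μ).dual.piece 0 ≃ₗ[k] W) := by
  have h := finrank_dualQ_piece μ 0
  have : FiniteDimensional k ((gradedQ μ).dual.piece 0) :=
    inferInstanceAs (FiniteDimensional k ((gradedQ μ).dual.piece (0 : ℕ)))
  refine FiniteDimensional.nonempty_linearEquiv_of_finrank_eq (h.trans ?_)
  rw [finrank_symPower_zero, zero_add, Nat.choose_one_right, mul_one]

theorem subsingleton_complexF_X [FiniteDimensional k V] {i : ℤ}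
    (hi : (Module.finrank k W : ℤ) ≤ i) : Subsingleton ((complexF μ).X i) := by
  have := subsingleton_dualQ_piece μ hi
  exact inferInstanceAs (Subsingleton (SymmetricAlgebra k V ⊗[k] (gradedQ μ).dual.piece i))

end Terms

end BGG

end

theorem theorem3p1 {k : Type*} [Field k] {U V W : Type*}
    [AddCommGroup U] [Module k U] [FiniteDimensional k U]
    [AddCommGroup V] [Module k V] [FiniteDimensional k V]
    [AddCommGroup W] [Module k W] [FiniteDimensional k W]
    (μ : W ⊗[k] U →ₗ[k] V) (hμ : BGG.IsGeometricallyOneGeneric μ)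
    (hW : Nontrivial W) (hU : Nontrivial U) (w : ℕ) (hw : w = Module.finrank k W) :
    -- `F(μ)` is a standard linear free complex and has a maximal irredundant quotient
    (BGG.complexF μ).IsStandardLinearFree ∧
    (∃ (F' : BGG.GradedComplex k V) (π : BGG.GradedComplex.Hom (BGG.complexF μ) F'),
      BGG.GradedComplex.IsMaximalIrredundantQuotient π) ∧
    -- the last term of `F(μ)` sits in position `w - 1`
    (∀ i : ℤ, (w : ℤ) ≤ i → Subsingleton ((BGG.complexF μ).X i)) ∧
    (∀ (F' : BGG.GradedComplex k V) (π : BGG.GradedComplex.Hom (BGG.complexF μ) F'),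
      BGG.GradedComplex.IsMaximalIrredundantQuotient π →
      -- `F(μ)` and `F'(μ)` have the same last term (and the same term in position `0`)
      Function.Bijective (π.f ((w : ℤ) - 1)) ∧ Function.Bijective (π.f 0) ∧
      (∀ i : ℤ, (w : ℤ) ≤ i → Subsingleton (F'.X i)) ∧
      -- the last term is `⋀^w W ⊗ D_{w-1}(U) ⊗ S(-w+1)`, the first one is `W ⊗ S`
      (∃ φ : F'.X ((w : ℤ) - 1) ≃ₗ[SymmetricAlgebra k V]
          SymmetricAlgebra k V ⊗[k] (⋀[k]^w W ⊗[k] BGG.dividedPower k U (w - 1)),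
        ∀ (n : ℤ) (x : F'.X ((w : ℤ) - 1)), x ∈ F'.deg ((w : ℤ) - 1) n ↔
          φ x ∈ BGG.freeDeg k V (⋀[k]^w W ⊗[k] BGG.dividedPower k U (w - 1)) ((w : ℤ) - 1) n) ∧
      (∃ ψ : F'.X 0 ≃ₗ[SymmetricAlgebra k V] SymmetricAlgebra k V ⊗[k] W,
        ∀ (n : ℤ) (x : F'.X 0), x ∈ F'.deg 0 n ↔ ψ x ∈ BGG.freeDeg k V W 0 n)) ∧
    -- the `(w - 1)`-minors of the associated linear matrix span `Sym_{w-1}(U^*)`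
    (∀ (bW : Module.Basis (Fin w) k W) (bV : Module.Basis (Fin (Module.finrank k V)) k V),
      BGG.minorSpan k (BGG.linearMatrix bW bV μ) (w - 1) =
        BGG.symPower k (Module.Dual k U) (w - 1)) := by
  subst hw
  obtain ⟨n, hn⟩ : ∃ n, Module.finrank k W = n + 1 :=
    Nat.exists_eq_add_one.2 Module.finrank_pos
  have hP : ∀ i : ℤ, i < 0 → Subsingleton ((BGG.gradedQ μ).dual.piece i) :=
    fun i hi => BGG.subsingleton_dualQ_piece_of_neg μ hi
  refine ⟨BGG.linComplex_isStandardLinearFree hP,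
    ⟨_, BGG.irrHom _, BGG.irrHom_isMaximalIrredundantQuotient hP⟩,
    fun i => BGG.subsingleton_complexF_X μ, fun F' π hπ => ?_, fun bW bV => ?_⟩
  · have h0 : Function.Bijective (π.f 0) :=
      BGG.bijective_of_redundant_eq_bot hP (BGG.redundant_zero _) hπ
    have hlast : Function.Bijective (π.f n) :=
      BGG.bijective_of_redundant_eq_bot hP (BGG.redundant_dualQ_eq_bot μ hμ hn) hπ
    have hn' : ((Module.finrank k W : ℕ) : ℤ) - 1 = n := by omega
    rw [hn']
    refine ⟨hlast, h0, fun i hi => ?_, ?_, ?_⟩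
    · have := BGG.subsingleton_complexF_X μ hi
      exact (hπ.surjective i).subsingleton
    · rw [hn, Nat.add_sub_cancel]
      obtain ⟨e⟩ := BGG.nonempty_dualQPieceEquiv μ n
      exact BGG.exists_equiv_of_bijective
        (T := ⋀[k]^(n + 1) W ⊗[k] BGG.dividedPower k U n) e hlast
    · obtain ⟨e⟩ := BGG.nonempty_dualQPieceEquiv_zero μ
      exact BGG.exists_equiv_of_bijective e h0
  -- Any `w - 1` of the `w` columns suffice; the first ones are taken.
  · exact BGG.minorSpan_eq_symPower hμ bW bV (Fin.castLEEmb (Nat.sub_le _ _))
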